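/- Throughout, graphs are finite, simple and undirected. A graph $G$ is an intersection graph of similarly sized $\beta$-fat objects in $\mathbb{R}^d$ if each vertex $v$ can be assigned a set $O_v\subseteq\mathbb{R}^d$ that contains a ball of radius $1$ and is contained in a ball of radius $\beta$, such that distinct vertices $u,v$ are adjacent if and only if $O_u\cap O_v\neq\emptyset$. The radius of a connected graph is the minimum over its vertices $v$ of the maximum distance from $v$ to a vertex. For all constants $d\geqslant 2$ and $\Delta\geqslant 1$ (integers), $\beta\geqslant 1$ and $c>0$ (reals), there exist constants $c'>0$ and $K>0$ and a randomized algorithm with the following property. The algorithm is given an integer $k\geqslant 4$ and a connected intersection graph $G$ of similarly sized $\beta$-fat objects in $\mathbb{R}^d$, of maximum degree at most $\Delta$ and radius at most $c\,k\log k$; only the graph is given (by its adjacency matrix), not its geometric representation. It always halts within a number of steps that is polynomial in the length of the input $(G,k)$, and it outputs a set $A\subseteq V(G)$ such that: 1. for every outcome of the random choices, the treewidth of the induced subgraph $G[A]$ is at most $K\,k^{1-1/d}\log k$; 2. for every set $X\subseteq V(G)$ of size at most $k$, the probability that $X\subseteq A$ is at least $2^{-c'(|X|+k)\,k^{-1/d}\log^2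 k}$. -/

import Mathlib

/-! ## Intersection graphs of similarly sized fat objects -/

/-- `G` is the intersection graph of a family of similarly sized `β`-fat objects in `ℝ^d`: every
vertex carries an object that contains a ball of radius `1` and lies in a ball of radius `β`, and
two distinct vertices are adjacent iff their objects meet. The inner ball is open and the outer one
closed, which is the most permissive reading of the definition. -/
def IsFatIntersectionGraph (d : ℕ) (β : ℝ) {V : Type*} (G : SimpleGraph V) : Prop :=
  ∃ O : V → Set (EuclideanSpace ℝ (Fin d)),
    (∀ v, ∃ x y : EuclideanSpace ℝ (Fin d),
      Metric.ball x 1 ⊆ O v ∧ O v ⊆ Metric.closedBall y β) ∧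
    ∀ u v, G.Adj u v ↔ u ≠ v ∧ (O u ∩ O v).Nonempty

/-! ## Treewidth -/

/-- Tree decompositions of a graph (over a finite tree, with finite bags). -/
structure TreeDecomposition {V : Type*} (G : SimpleGraph V) where
  /-- the nodes of the tree -/
  Node : Type
  finite_node : Finite Node
  tree : SimpleGraph Node
  isTree : tree.IsTree
  bag : Node → Finset V
  covers : ∀ v, ∃ t, v ∈ bag t
  covers_edge : ∀ u v, G.Adj u v → ∃ t, u ∈ bag t ∧ v ∈ bag t
  connected : ∀ v, (tree.induce {t | v ∈ bag t}).Preconnected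

/-- The treewidth of a finite graph: the least `w` such that some tree decomposition has all its
bags of size at most `w + 1` (the graph without vertices gets the value `0`). -/
noncomputable def treewidth {V : Type*} (G : SimpleGraph V) : ℕ :=
  sInf {w | ∃ D : TreeDecomposition G, ∀ t, (D.bag t).card ≤ w + 1}

/-! ## Randomized algorithms

The machine is a random access machine with natural-number contents, programmed in a structured
language. It has scalar variables and arrays, both named by natural numbers (a program names
finitely many of them). The only arithmetic is addition and truncated subtraction, so that in `t`
steps a program produces only numbers of `O(t + input length)` bits, and counting each elementary
command as one step is polynomially equivalent to the Turing machine cost. The only source of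
randomness is the tossing of a fair coin. -/

/-- The contents of the memory. -/
structure Memory where
  var : ℕ → ℕ
  arr : ℕ → ℕ → ℕ

/-- Expressions. -/
inductive RExpr where
  | const (m : ℕ)
  | var (x : ℕ)
  | get (a : ℕ) (i : RExpr)
  | add (e f : RExpr)
  | sub (e f : RExpr)

/-- The value of an expression; `sub` is truncated subtraction. -/
def RExpr.eval (s : Memory) : RExpr → ℕ
  | .const m => m
  | .var x => s.var x
  | .get a i => s.arr a (i.eval s)
  | .add e f => e.eval s + f.eval s
  | .sub e f => e.eval s - f.eval s

/-- Programs. A condition counts as true iff its value is not `0`. -/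
inductive RProg where
  | skip
  | assign (x : ℕ) (e : RExpr)
  | store (a : ℕ) (i e : RExpr)
  | flip (x : ℕ)
  | seq (p q : RProg)
  | cond (e : RExpr) (p q : RProg)
  | loop (e : RExpr) (p : RProg)

/-- Set a scalar variable. -/
def Memory.setVar (s : Memory) (x m : ℕ) : Memory :=
  { s with var := Function.update s.var x m }

/-- Set an array cell. -/
def Memory.setArr (s : Memory) (a i m : ℕ) : Memory :=
  { s with arr := Function.update s.arr a (Function.update (s.arr a) i m) }

/-- A configuration: the programs that are still to be executed, in order, and the memory. -/
structure RConfig where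
  todo : List RProg
  mem : Memory

/-- One step of the machine. A configuration with nothing left to do has halted and stays. -/
noncomputable def RConfig.step : RConfig → PMF RConfig
  | ⟨[], s⟩ => PMF.pure ⟨[], s⟩
  | ⟨.skip :: K, s⟩ => PMF.pure ⟨K, s⟩
  | ⟨.assign x e :: K, s⟩ => PMF.pure ⟨K, s.setVar x (e.eval s)⟩
  | ⟨.store a i e :: K, s⟩ => PMF.pure ⟨K, s.setArr a (i.eval s) (e.eval s)⟩
  | ⟨.flip x :: K, s⟩ =>
      (PMF.uniformOfFintype Bool).map fun b => ⟨K, s.setVar x (if b then 1 else 0)⟩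
  | ⟨.seq p q :: K, s⟩ => PMF.pure ⟨p :: q :: K, s⟩
  | ⟨.cond e p q :: K, s⟩ => PMF.pure ⟨(if e.eval s ≠ 0 then p else q) :: K, s⟩
  | ⟨.loop e p :: K, s⟩ =>
      PMF.pure (if e.eval s ≠ 0 then ⟨p :: .loop e p :: K, s⟩ else ⟨K, s⟩)

/-- The distribution of the configuration after `t` steps. -/
noncomputable def RConfig.run : ℕ → RConfig → PMF RConfig
  | 0, C => PMF.pure C
  | t + 1, C => C.step.bind (RConfig.run t)

/-- The initial memory for the input `(G, k)`: variable `0` holds the number `n` of vertices,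
variable `1` holds `k`, array `0` holds the adjacency matrix of `G` row by row, and everything else
is `0`. -/
def inputMemory {n : ℕ} (G : SimpleGraph (Fin n)) [DecidableRel G.Adj] (k : ℕ) : Memory where
  var x := if x = 0 then n else if x = 1 then k else 0
  arr a i := if a = 0 ∧ ∃ u v : Fin n, i = u * n + v ∧ G.Adj u v then 1 else 0

/-- The length of the input `(G, k)`: the `n²` bits of the adjacency matrix and the binary digits
of `k`. -/
def inputLength (n k : ℕ) : ℕ := n ^ 2 + Nat.size k

/-- The vertex set that the program outputs: array `1` holds its indicator function. -/
def Memory.outputSet (n : ℕ) (s : Memory) : Set (Fin n) := {v | s.arr 1 v ≠ 0}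

/-- Whatever the coins show, the program halts on the input `(G, k)` within `t` steps. -/
def RProg.HaltsWithin (P : RProg) {n : ℕ} (G : SimpleGraph (Fin n)) [DecidableRel G.Adj]
    (k t : ℕ) : Prop :=
  ∀ C ∈ (RConfig.run t ⟨[P], inputMemory G k⟩).support, C.todo = []

/-- The distribution of the vertex set read off after `t` steps on the input `(G, k)`; if the
program halts within `t` steps, this is the distribution of its output. -/
noncomputable def RProg.outputDist (P : RProg) {n : ℕ} (G : SimpleGraph (Fin n))
    [DecidableRel G.Adj] (k t : ℕ) : PMF (Set (Fin n)) :=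
  (RConfig.run t ⟨[P], inputMemory G k⟩).map fun C => C.mem.outputSet n

/-! ## Big-step rules for the machine -/

theorem RConfig.run_add (a b : ℕ) (C : RConfig) :
    RConfig.run (a + b) C = (RConfig.run a C).bind (RConfig.run b) := by
  induction a generalizing C with
  | zero => simp [RConfig.run]
  | succ a ih =>
    rw [Nat.succ_add]
    simp only [RConfig.run, PMF.bind_bind]
    exact congrArg _ (funext ih)

theorem RConfig.run_halted (t : ℕ) (s : Memory) : RConfig.run t ⟨[], s⟩ = PMF.pure ⟨[], s⟩ := by
  induction t with
  | zero => rfl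
  | succ t ih => simp [RConfig.run, RConfig.step, ih]

/-- Without tossing coins, `p` leads from the memory `s` to the memory `s₁` in `t` steps. -/
def RProg.Exec (p : RProg) (s : Memory) (t : ℕ) (s₁ : Memory) : Prop :=
  ∀ K, RConfig.run t ⟨p :: K, s⟩ = PMF.pure ⟨K, s₁⟩

/-- Without tossing coins, `p` leads from `s` to a memory satisfying `Q` in at most `c` steps. -/
def RProg.Runs (p : RProg) (s : Memory) (c : ℕ) (Q : Memory → Prop) : Prop :=
  ∃ t ≤ c, ∃ s', p.Exec s t s' ∧ Q s'

namespace RProg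

theorem Runs.mono {p : RProg} {s : Memory} {c c' : ℕ} {Q Q' : Memory → Prop}
    (h : p.Runs s c Q) (hc : c ≤ c') (hQ : ∀ s', Q s' → Q' s') : p.Runs s c' Q' := by
  obtain ⟨t, ht, s', he, hq⟩ := h
  exact ⟨t, ht.trans hc, s', he, hQ _ hq⟩

theorem runs_assign {x : ℕ} {e : RExpr} {s : Memory} {Q : Memory → Prop}
    (h : Q (s.setVar x (e.eval s))) : (assign x e).Runs s 1 Q :=
  ⟨1, le_rfl, _, fun K => by simp [RConfig.run, RConfig.step], h⟩

theorem runs_store {a : ℕ} {i e : RExpr} {s : Memory} {Q : Memory → Prop}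
    (h : Q (s.setArr a (i.eval s) (e.eval s))) : (store a i e).Runs s 1 Q :=
  ⟨1, le_rfl, _, fun K => by simp [RConfig.run, RConfig.step], h⟩

theorem Exec.seq {p q : RProg} {s s₁ s₂ : Memory} {a b : ℕ} (hp : p.Exec s a s₁)
    (hq : q.Exec s₁ b s₂) : (RProg.seq p q).Exec s (a + b + 1) s₂ := by
  intro K
  simp only [RConfig.run, RConfig.step, PMF.pure_bind, RConfig.run_add, hp _, hq K]

theorem Runs.seq {p q : RProg} {s : Memory} {a b : ℕ} {Q R : Memory → Prop} (hp : p.Runs s a Q)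
    (hq : ∀ s₁, Q s₁ → q.Runs s₁ b R) : (RProg.seq p q).Runs s (a + b + 1) R := by
  obtain ⟨t, ht, s₁, he, h₁⟩ := hp
  obtain ⟨u, hu, s₂, he', h₂⟩ := hq _ h₁
  exact ⟨t + u + 1, by omega, s₂, he.seq he', h₂⟩

theorem runs_cond {e : RExpr} {p q : RProg} {s : Memory} {c : ℕ} {Q : Memory → Prop}
    (hp : e.eval s ≠ 0 → p.Runs s c Q) (hq : e.eval s = 0 → q.Runs s c Q) :
    (cond e p q).Runs s (c + 1) Q := by
  by_cases h : e.eval s = 0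
  · obtain ⟨t, ht, s', he, h'⟩ := hq h
    refine ⟨t + 1, by omega, s', fun K => ?_, h'⟩
    simp [RConfig.run, RConfig.step, h, he K]
  · obtain ⟨t, ht, s', he, h'⟩ := hp h
    refine ⟨t + 1, by omega, s', fun K => ?_, h'⟩
    simp [RConfig.run, RConfig.step, h, he K]

theorem runs_loop_exit {e : RExpr} {p : RProg} {s : Memory} {Q : Memory → Prop}
    (h : e.eval s = 0) (hQ : Q s) : (loop e p).Runs s 1 Q :=
  ⟨1, le_rfl, s, fun K => by simp [RConfig.run, RConfig.step, h], hQ⟩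

theorem runs_loop_step {e : RExpr} {p : RProg} {s : Memory} {a b : ℕ} {Q R : Memory → Prop}
    (h : e.eval s ≠ 0) (hp : p.Runs s a Q) (hl : ∀ s₁, Q s₁ → (loop e p).Runs s₁ b R) :
    (loop e p).Runs s (a + b + 1) R := by
  obtain ⟨t, ht, s₁, he, h₁⟩ := hp
  obtain ⟨u, hu, s₂, he', h₂⟩ := hl _ h₁
  refine ⟨t + u + 1, by omega, s₂, fun K => ?_, h₂⟩
  simp [RConfig.run, RConfig.step, RConfig.run_add, h, he _, he' K]

/-- Execute `p` with the variable `x` running from its present value up to the value of the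
variable `2`. -/
def countLoop (x : ℕ) (p : RProg) : RProg :=
  loop (.sub (.var 2) (.var x)) (seq p (assign x (.add (.var x) (.const 1))))

theorem runs_countLoop {x : ℕ} {p : RProg} {N c : ℕ} (Inv : ℕ → Memory → Prop)
    (hx : ∀ i s, Inv i s → s.var x = i ∧ s.var 2 = N)
    (hp : ∀ i s, i < N → Inv i s → p.Runs s c fun s' => Inv (i + 1) (s'.setVar x (s'.var x + 1)))
    {s : Memory} (h : Inv 0 s) : (countLoop x p).Runs s (N * (c + 3) + 1) (Inv N) := by
  have key : ∀ m i s, i + m = N → Inv i s → (countLoop x p).Runs s (m * (c + 3) + 1) (Inv N) := by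
    intro m
    induction m with
    | zero =>
      intro i s hi hs
      obtain ⟨h1, h2⟩ := hx i s hs
      refine (runs_loop_exit (by simp [RExpr.eval, h1, h2]; omega) ?_).mono (by omega)
        fun _ h => h
      rwa [show N = i by omega]
    | succ m ih =>
      intro i s hi hs
      obtain ⟨h1, h2⟩ := hx i s hs
      refine (runs_loop_step (Q := Inv (i + 1)) (by simp [RExpr.eval, h1, h2]; omega)
        ((hp i s (by omega) hs).seq fun s₁ h₁ => runs_assign (by simpa [RExpr.eval] using h₁))
        fun s₁ h₁ => ih (i + 1) s₁ (by omega) h₁).mono (by ring_nf; omega) fun _ h => h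
  exact key N 0 s (by omega) h

end RProg

@[simp] theorem Memory.setVar_var (s : Memory) (x m y : ℕ) :
    (s.setVar x m).var y = if y = x then m else s.var y := by
  simp [Memory.setVar, Function.update_apply]

@[simp] theorem Memory.setVar_arr (s : Memory) (x m : ℕ) : (s.setVar x m).arr = s.arr := rfl

@[simp] theorem Memory.setArr_var (s : Memory) (a i m : ℕ) : (s.setArr a i m).var = s.var := rfl

@[simp] theorem Memory.setArr_arr (s : Memory) (a i m b j : ℕ) :
    (s.setArr a i m).arr b j = if b = a ∧ j = i then m else s.arr b j := by
  by_cases h : b = a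
  · subst h; simp [Memory.setArr, Function.update_apply]
  · simp [Memory.setArr, h]

/-! ## A language of bounded computations

Expressions with sums over `i < N`, where the bound `N` is fixed throughout, and statements built
from assignments, parallel array updates and `N`-fold repetition. Names from `100` on are reserved
for the translation into machine programs. -/

/-- Two memories agree on all names below `100`. -/
structure Memory.Agree (s s' : Memory) : Prop where
  var : ∀ x < 100, s.var x = s'.var x
  arr : ∀ a < 100, s.arr a = s'.arr a

theorem Memory.Agree.trans {s s' s'' : Memory} (h : s.Agree s') (h' : s'.Agree s'') :
    s.Agree s'' :=
  ⟨fun x hx => (h.var x hx).trans (h'.var x hx), fun a ha => (h.arr a ha).trans (h'.arr a ha)⟩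

theorem Memory.Agree.setVar {s s' : Memory} (h : s.Agree s') (x m : ℕ) :
    (s.setVar x m).Agree (s'.setVar x m) :=
  ⟨fun y hy => by simp [h.var y hy], h.arr⟩

/-- Expressions with bounded summation. -/
inductive SumExpr where
  | const (m : ℕ)
  | var (x : ℕ)
  | get (a : ℕ) (e : SumExpr)
  | add (e f : SumExpr)
  | sub (e f : SumExpr)
  | ite (c e f : SumExpr)
  | sum (x : ℕ) (e : SumExpr)

namespace SumExpr

/-- The value of an expression; sums range over the numbers below `N`. -/
def eval (N : ℕ) : SumExpr → Memory → ℕ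
  | const m, _ => m
  | var x, s => s.var x
  | get a e, s => s.arr a (e.eval N s)
  | add e f, s => e.eval N s + f.eval N s
  | sub e f, s => e.eval N s - f.eval N s
  | ite c e f, s => if c.eval N s ≠ 0 then e.eval N s else f.eval N s
  | sum x e, s => ∑ i ∈ Finset.range N, e.eval N (s.setVar x i)

/-- All names are below `100`, and the variable `2`, which holds `N`, is not bound. -/
def WF : SumExpr → Prop
  | const _ => True
  | var x => x < 100
  | get a e => a < 100 ∧ e.WF
  | add e f => e.WF ∧ f.WF
  | sub e f => e.WF ∧ f.WF
  | ite c e f => c.WF ∧ e.WF ∧ f.WF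
  | sum x e => x < 100 ∧ x ≠ 2 ∧ e.WF

/-- The translation into a machine program that leaves the value in the variable `h` and uses
only variables from `h` on as auxiliary ones. -/
def compile : ℕ → SumExpr → RProg
  | h, const m => .assign h (.const m)
  | h, var x => .assign h (.var x)
  | h, get a e => .seq (compile h e) (.assign h (.get a (.var h)))
  | h, add e f =>
      .seq (compile h e) (.seq (compile (h + 1) f) (.assign h (.add (.var h) (.var (h + 1)))))
  | h, sub e f =>
      .seq (compile h e) (.seq (compile (h + 1) f) (.assign h (.sub (.var h) (.var (h + 1)))))
  | h, ite c e f => .seq (compile h c) (.cond (.var h) (compile h e) (compile h f))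
  | h, sum x e =>
      .seq (.assign h (.var x)) (.seq (.assign (h + 1) (.const 0)) (.seq (.assign x (.const 0))
        (.seq (RProg.countLoop x (.seq (compile (h + 2) e)
          (.assign (h + 1) (.add (.var (h + 1)) (.var (h + 2))))))
          (.seq (.assign x (.var h)) (.assign h (.var (h + 1)))))))

/-- A bound for the number of steps as a polynomial in `N`. -/
noncomputable def cost : SumExpr → Polynomial ℕ
  | const _ => 1
  | var _ => 1
  | get _ e => e.cost + 2
  | add e f => e.cost + f.cost + 3
  | sub e f => e.cost + f.cost + 3
  | ite c e f => c.cost + (e.cost + f.cost) + 2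
  | sum _ e => Polynomial.X * (e.cost + 5) + 11

theorem eval_congr (N : ℕ) {e : SumExpr} (he : e.WF) {s s' : Memory} (h : s.Agree s') :
    e.eval N s = e.eval N s' := by
  induction e generalizing s s' with
  | const m => rfl
  | var x => exact h.var x he
  | get a e ih => simp only [eval, ih he.2 h, h.arr a he.1]
  | add e f ihe ihf => simp only [eval, ihe he.1 h, ihf he.2 h]
  | sub e f ihe ihf => simp only [eval, ihe he.1 h, ihf he.2 h]
  | ite c e f ihc ihe ihf => simp only [eval, ihc he.1 h, ihe he.2.1 h, ihf he.2.2 h]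
  | sum x e ih =>
    exact Finset.sum_congr rfl fun i _ => ih he.2.2 (h.setVar x i)

theorem runs_compile {N : ℕ} {e : SumExpr} (he : e.WF) {h : ℕ} (hh : 100 ≤ h) {s : Memory}
    (hs : s.var 2 = N) : (e.compile h).Runs s (e.cost.eval N) fun s' =>
      s'.arr = s.arr ∧ (∀ x < h, s'.var x = s.var x) ∧ s'.var h = e.eval N s := by
  induction e generalizing h s with
  | const m =>
    refine (RProg.runs_assign ?_).mono (by simp [cost]) fun _ h => h
    refine ⟨rfl, fun x hx => ?_, ?_⟩ <;> simp [RExpr.eval, eval]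
    omega
  | var x =>
    refine (RProg.runs_assign ?_).mono (by simp [cost]) fun _ h => h
    refine ⟨rfl, fun x hx => ?_, ?_⟩ <;> simp [RExpr.eval, eval]
    omega
  | get a e ih =>
    refine ((ih he.2 hh hs).seq fun s₁ h₁ => RProg.runs_assign ?_).mono (by simp [cost])
      fun _ h => h
    obtain ⟨ha, hv, hr⟩ := h₁
    refine ⟨by simp [ha], fun x hx => ?_, ?_⟩
    · simp [hx.ne, hv x hx]
    · simp [RExpr.eval, eval, hr, ha]
  | add e f ihe ihf =>
    refine ((ihe he.1 hh hs).seq fun s₁ h₁ => ((ihf he.2 (h := h + 1) (by omega)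
      (s := s₁) (by rw [h₁.2.1 2 (by omega), hs])).seq fun s₂ h₂ =>
        RProg.runs_assign ?_)).mono (by simp [cost]; omega) fun _ h => h
    obtain ⟨ha, hv, hr⟩ := h₁
    obtain ⟨ha', hv', hr'⟩ := h₂
    refine ⟨by simp [ha, ha'], fun x hx => ?_, ?_⟩
    · simp [hx.ne, hv x hx, hv' x (by omega)]
    · have : f.eval N s₁ = f.eval N s :=
        eval_congr N he.2 ⟨fun x hx => hv x (by omega), fun a _ => by rw [ha]⟩
      simp [RExpr.eval, eval, hr, hv' h (by omega), hr', this]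
  | sub e f ihe ihf =>
    refine ((ihe he.1 hh hs).seq fun s₁ h₁ => ((ihf he.2 (h := h + 1) (by omega)
      (s := s₁) (by rw [h₁.2.1 2 (by omega), hs])).seq fun s₂ h₂ =>
        RProg.runs_assign ?_)).mono (by simp [cost]; omega) fun _ h => h
    obtain ⟨ha, hv, hr⟩ := h₁
    obtain ⟨ha', hv', hr'⟩ := h₂
    refine ⟨by simp [ha, ha'], fun x hx => ?_, ?_⟩
    · simp [hx.ne, hv x hx, hv' x (by omega)]
    · have : f.eval N s₁ = f.eval N s :=
        eval_congr N he.2 ⟨fun x hx => hv x (by omega), fun a _ => by rw [ha]⟩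
      simp [RExpr.eval, eval, hr, hv' h (by omega), hr', this]
  | ite c e f ihc ihe ihf =>
    refine ((ihc he.1 hh hs).seq fun s₁ h₁ => RProg.runs_cond
      (c := e.cost.eval N + f.cost.eval N)
      (fun hne => (ihe he.2.1 hh (s := s₁) (by rw [h₁.2.1 2 (by omega), hs])).mono (by omega)
        fun s₂ h₂ => ?_)
      (fun hne => (ihf he.2.2 hh (s := s₁) (by rw [h₁.2.1 2 (by omega), hs])).mono (by omega)
        fun s₂ h₂ => ?_)).mono (by simp [cost]; omega) fun _ h => h
    all_goals
      obtain ⟨ha, hv, hr⟩ := h₁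
      obtain ⟨ha', hv', hr'⟩ := h₂
      have hagree : s₁.Agree s := ⟨fun x hx => hv x (by omega), fun a _ => by rw [ha]⟩
      refine ⟨ha'.trans ha, fun x hx => (hv' x hx).trans (hv x hx), ?_⟩
    · rw [hr', eval_congr N he.2.1 hagree]
      simp only [RExpr.eval, hr] at hne
      simp [eval, hne]
    · rw [hr', eval_congr N he.2.2 hagree]
      simp only [RExpr.eval, hr] at hne
      simp [eval, hne]
  | sum x e ih =>
    obtain ⟨hx, hx2, he⟩ := he
    let Inv : ℕ → Memory → Prop := fun i s' =>
      s'.arr = s.arr ∧ (∀ y < h, y ≠ x → s'.var y = s.var y) ∧ s'.var x = i ∧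
        s'.var h = s.var x ∧ s'.var (h + 1) = ∑ j ∈ Finset.range i, e.eval N (s.setVar x j)
    have hloop : ∀ s₁, Inv 0 s₁ → (RProg.countLoop x (.seq (compile (h + 2) e)
          (.assign (h + 1) (.add (.var (h + 1)) (.var (h + 2)))))).Runs s₁
            (N * ((e.cost.eval N + 1 + 1) + 3) + 1) (Inv N) := by
      intro s₁ h₁
      refine RProg.runs_countLoop Inv ?_ ?_ h₁
      · intro i s' hi
        exact ⟨hi.2.2.1, by rw [hi.2.1 2 (by omega) hx2.symm, hs]⟩
      · rintro i s₂ - ⟨i1, i2, i3, i4, i5⟩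
        refine (ih he (h := h + 2) (by omega) (s := s₂)
          (by rw [i2 2 (by omega) hx2.symm, hs])).seq fun s₃ h₃ => RProg.runs_assign ?_
        obtain ⟨ha, hv, hr⟩ := h₃
        have hval : e.eval N s₂ = e.eval N (s.setVar x i) := by
          refine eval_congr N he ⟨fun y hy => ?_, fun a _ => by rw [i1]; rfl⟩
          by_cases hyx : y = x
          · simp [hyx, i3]
          · simp [hyx, i2 y (by omega) hyx]
        refine ⟨by simp [ha, i1], fun y hy hyx => ?_, ?_, ?_, ?_⟩
        · simp [hyx, hv y (by omega), i2 y hy hyx, show y ≠ h + 1 by omega]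
        · simp [hv x (by omega), i3, show x ≠ h + 1 by omega]
        · simp [show h ≠ x by omega, hv h (by omega), i4]
        · simp [show h + 1 ≠ x by omega, RExpr.eval, hv (h + 1) (by omega), i5, hr, hval,
            Finset.sum_range_succ]
    refine ((RProg.runs_assign (Q := fun s' => s'.arr = s.arr ∧ (∀ y < h, s'.var y = s.var y) ∧
        s'.var h = s.var x) ?_).seq fun s₁ h₁ =>
      ((RProg.runs_assign (Q := fun s' => s'.arr = s.arr ∧ (∀ y < h, s'.var y = s.var y) ∧
        s'.var h = s.var x ∧ s'.var (h + 1) = 0) ?_).seq fun s₂ h₂ =>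
      ((RProg.runs_assign (Q := Inv 0) ?_).seq fun s₃ h₃ => ((hloop s₃ h₃).seq fun s₄ h₄ =>
        (((RProg.runs_assign (Q := fun s' => s'.arr = s.arr ∧ (∀ y < h, s'.var y = s.var y) ∧
          s'.var (h + 1) = (SumExpr.sum x e).eval N s) ?_).seq fun s₅ h₅ =>
            RProg.runs_assign ?_)))))).mono ?_ fun _ h => h
    · refine ⟨rfl, fun y hy => ?_, ?_⟩
      · simp [hy.ne]
      · simp [RExpr.eval]
    · refine ⟨by simp [h₁.1], fun y hy => ?_, ?_, ?_⟩
      · simp [h₁.2.1 y hy, show y ≠ h + 1 by omega]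
      · simp [h₁.2.2]
      · simp [RExpr.eval]
    · refine ⟨by simp [h₂.1], fun y hy hyx => ?_, ?_, ?_, ?_⟩
      · simp [h₂.2.1 y hy, hyx]
      · simp [RExpr.eval]
      · simp [h₂.2.2.1, show h ≠ x by omega]
      · simp [h₂.2.2.2, show h + 1 ≠ x by omega]
    · obtain ⟨i1, i2, i3, i4, i5⟩ := h₄
      refine ⟨by simp [i1], fun y hy => ?_, ?_⟩
      · by_cases hyx : y = x
        · simp [hyx, RExpr.eval, i4]
        · simp [hyx, i2 y hy hyx]
      · simp [show h + 1 ≠ x by omega, i5, eval]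
    · refine ⟨by simp [h₅.1], fun y hy => ?_, ?_⟩
      · simp [hy.ne, h₅.2.1 y hy]
      · simp [RExpr.eval, h₅.2.2]
    · simp [cost]; ring_nf; omega

end SumExpr

/-- Statements. -/
inductive SumStmt where
  | set (x : ℕ) (e : SumExpr)
  | fill (a x : ℕ) (e : SumExpr)
  | seq (p q : SumStmt)
  | rep (p : SumStmt)

namespace SumStmt

/-- The effect of a statement on the memory. The statement `fill a x e` overwrites the cells `i < N`
of the array `a` by the values of `e` at `x = i`, and `rep p` executes `p` exactly `N` times. -/
def eval (N : ℕ) : SumStmt → Memory → Memory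
  | set x e, s => s.setVar x (e.eval N s)
  | fill a x e, s => { s with
      arr := Function.update s.arr a fun i =>
        if i < N then e.eval N (s.setVar x i) else s.arr a i }
  | seq p q, s => q.eval N (p.eval N s)
  | rep p, s => (p.eval N)^[N] s

/-- All names are below `100`, and the variable `2`, which holds `N`, is not written. -/
def WF : SumStmt → Prop
  | set x e => x < 100 ∧ x ≠ 2 ∧ e.WF
  | fill a x e => a < 100 ∧ x < 100 ∧ x ≠ 2 ∧ e.WF
  | seq p q => p.WF ∧ q.WF
  | rep p => p.WF

/-- The translation into a machine program that uses only variables from `h` on and the array `100`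
as auxiliary ones. -/
def compile : ℕ → SumStmt → RProg
  | h, set x e => .seq (e.compile h) (.assign x (.var h))
  | h, fill a x e =>
      .seq (.assign h (.var x)) (.seq (.assign x (.const 0))
        (.seq (RProg.countLoop x (.seq (e.compile (h + 1)) (.store 100 (.var x) (.var (h + 1)))))
          (.seq (.assign x (.const 0)) (.seq
            (RProg.countLoop x (.store a (.var x) (.get 100 (.var x)))) (.assign x (.var h))))))
  | h, seq p q => .seq (compile h p) (compile h q)
  | h, rep p => .seq (.assign h (.const 0)) (RProg.countLoop h (compile (h + 1) p))

/-- A bound for the number of steps as a polynomial in `N`. -/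
noncomputable def cost : SumStmt → Polynomial ℕ
  | set _ e => e.cost + 2
  | fill _ _ e => Polynomial.X * (e.cost + 9) + 11
  | seq p q => p.cost + q.cost + 1
  | rep p => Polynomial.X * (p.cost + 3) + 3

/-- The variables that a statement writes. -/
def vars : SumStmt → List ℕ
  | set x _ => [x]
  | fill _ _ _ => []
  | seq p q => p.vars ++ q.vars
  | rep p => p.vars

/-- The arrays that a statement writes. -/
def arrs : SumStmt → List ℕ
  | set _ _ => []
  | fill a _ _ => [a]
  | seq p q => p.arrs ++ q.arrs
  | rep p => p.arrs

theorem eval_var (N : ℕ) {p : SumStmt} {x : ℕ} (hx : x ∉ p.vars) (s : Memory) :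
    (p.eval N s).var x = s.var x := by
  induction p generalizing s with
  | set y e => simp only [vars, List.mem_singleton] at hx; simp [eval, hx]
  | fill a y e => rfl
  | seq p q ihp ihq =>
    simp only [vars, List.mem_append, not_or] at hx
    simp only [eval, ihq hx.2, ihp hx.1]
  | rep p ih =>
    have : ∀ m, ((p.eval N)^[m] s).var x = s.var x := by
      intro m
      induction m with
      | zero => rfl
      | succ m ihm => rw [Function.iterate_succ_apply', ih hx, ihm]
    exact this N

theorem eval_arr (N : ℕ) {p : SumStmt} {a : ℕ} (ha : a ∉ p.arrs) (s : Memory) :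
    (p.eval N s).arr a = s.arr a := by
  induction p generalizing s with
  | set y e => rfl
  | fill b y e => simp only [arrs, List.mem_singleton] at ha; simp [eval, ha]
  | seq p q ihp ihq =>
    simp only [arrs, List.mem_append, not_or] at ha
    simp only [eval, ihq ha.2, ihp ha.1]
  | rep p ih =>
    have : ∀ m, ((p.eval N)^[m] s).arr a = s.arr a := by
      intro m
      induction m with
      | zero => rfl
      | succ m ihm => rw [Function.iterate_succ_apply', ih ha, ihm]
    exact this N

theorem eval_congr (N : ℕ) {p : SumStmt} (hp : p.WF) {s s' : Memory} (h : s.Agree s') :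
    (p.eval N s).Agree (p.eval N s') := by
  induction p generalizing s s' with
  | set x e =>
    simp only [eval, SumExpr.eval_congr N hp.2.2 h]
    exact h.setVar _ _
  | fill a x e =>
    refine ⟨h.var, fun b hb => ?_⟩
    by_cases hba : b = a
    · subst hba
      simp only [eval, Function.update_self, h.arr b hb]
      funext i
      rw [SumExpr.eval_congr N hp.2.2.2 (h.setVar x i)]
    · simp [eval, hba, h.arr b hb]
  | seq p q ihp ihq => exact ihq hp.2 (ihp hp.1 h)
  | rep p ih =>
    have : ∀ m, ((p.eval N)^[m] s).Agree ((p.eval N)^[m] s') := by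
      intro m
      induction m with
      | zero => exact h
      | succ m ihm => simp only [Function.iterate_succ_apply']; exact ih hp ihm
    exact this N

theorem vars_of_wf {p : SumStmt} (hp : p.WF) : 2 ∉ p.vars ∧ ∀ x ∈ p.vars, x < 100 := by
  induction p with
  | set x e => exact ⟨by simpa [vars] using hp.2.1.symm, by simpa [vars] using hp.1⟩
  | fill a x e => simp [vars]
  | seq p q ihp ihq =>
    have h1 := ihp hp.1
    have h2 := ihq hp.2
    simp only [vars, List.mem_append]
    exact ⟨by tauto, fun x hx => hx.elim (h1.2 x) (h2.2 x)⟩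
  | rep p ih => exact ih hp

theorem runs_compile {N : ℕ} {p : SumStmt} (hp : p.WF) {h : ℕ} (hh : 100 ≤ h) {s : Memory}
    (hs : s.var 2 = N) : (p.compile h).Runs s (p.cost.eval N) fun s' =>
      s'.Agree (p.eval N s) ∧ ∀ x < h, 100 ≤ x → s'.var x = s.var x := by
  induction p generalizing h s with
  | set x e =>
    refine ((SumExpr.runs_compile hp.2.2 hh hs).seq fun s₁ h₁ => RProg.runs_assign ?_).mono
      (by simp [cost]) fun _ h => h
    obtain ⟨ha, hv, hr⟩ := h₁
    refine ⟨⟨fun y hy => ?_, fun a _ => by simp [ha, eval]⟩, fun y hy hy' => ?_⟩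
    · simp [RExpr.eval, hr, eval, hv y (by omega)]
    · have := hp.1
      simp [show y ≠ x by omega, hv y hy]
  | seq p q ihp ihq =>
    refine ((ihp hp.1 hh hs).seq fun s₁ h₁ => (ihq hp.2 hh (s := s₁) ?_).mono le_rfl
      fun s₂ h₂ => ?_).mono (by simp [cost]) fun _ h => h
    · rw [h₁.1.var 2 (by omega), eval_var N (vars_of_wf hp.1).1, hs]
    · exact ⟨h₂.1.trans (eval_congr N hp.2 h₁.1),
        fun x hx hx' => (h₂.2 x hx hx').trans (h₁.2 x hx hx')⟩
  | rep p ih =>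
    let Inv : ℕ → Memory → Prop := fun i s' =>
      s'.Agree ((p.eval N)^[i] s) ∧ (∀ x < h, 100 ≤ x → s'.var x = s.var x) ∧ s'.var h = i
    have h2 : ∀ i, ((p.eval N)^[i] s).var 2 = N := by
      intro i
      induction i with
      | zero => exact hs
      | succ i ihi => rw [Function.iterate_succ_apply', eval_var N (vars_of_wf (p := p) hp).1, ihi]
    have hloop : ∀ s₁, Inv 0 s₁ → (RProg.countLoop h (compile (h + 1) p)).Runs s₁
        (N * (p.cost.eval N + 3) + 1) (Inv N) := by
      intro s₁ h₁
      refine RProg.runs_countLoop Inv ?_ ?_ h₁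
      · intro i s' hi
        exact ⟨hi.2.2, by rw [hi.1.var 2 (by omega), h2]⟩
      · rintro i s₂ - ⟨i1, i2, i3⟩
        refine (ih hp (h := h + 1) (by omega) (s := s₂)
          (by rw [i1.var 2 (by omega), h2])).mono le_rfl fun s₃ h₃ => ?_
        have key := h₃.1.trans (eval_congr N (p := p) hp i1)
        refine ⟨⟨fun y hy => ?_, fun a ha => ?_⟩, fun y hy hy' => ?_, ?_⟩
        · rw [Function.iterate_succ_apply', ← key.var y hy]
          simp [show y ≠ h by omega]
        · rw [Function.iterate_succ_apply', ← key.arr a ha]; rfl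
        · simp [hy.ne, h₃.2 y (by omega) hy', i2 y hy hy']
        · simp [h₃.2 h (by omega) hh, i3]
    refine ((RProg.runs_assign (Q := Inv 0) ?_).seq fun s₁ h₁ => (hloop s₁ h₁).mono le_rfl
      fun s₂ h₂ => ?_).mono (by simp [cost]; ring_nf; omega) fun _ h => h
    · refine ⟨⟨fun y hy => ?_, fun a _ => rfl⟩, fun y hy hy' => ?_, ?_⟩
      · simp [show y ≠ h by omega]
      · simp [hy.ne]
      · simp [RExpr.eval]
    · exact ⟨h₂.1, h₂.2.1⟩
  | fill a x e =>
    obtain ⟨ha, hx, hx2, he⟩ := hp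
    let Inv : ℕ → Memory → Prop := fun i s' =>
      (∀ b < 100, s'.arr b = s.arr b) ∧ (∀ y < h, y ≠ x → s'.var y = s.var y) ∧ s'.var x = i ∧
        s'.var h = s.var x ∧ ∀ j < i, s'.arr 100 j = e.eval N (s.setVar x j)
    let Inv' : ℕ → Memory → Prop := fun i s' =>
      (∀ b < 100, b ≠ a → s'.arr b = s.arr b) ∧ (∀ y < h, y ≠ x → s'.var y = s.var y) ∧
        s'.var x = i ∧ s'.var h = s.var x ∧ (∀ j < N, s'.arr 100 j = e.eval N (s.setVar x j)) ∧
        ∀ j, s'.arr a j = if j < i then e.eval N (s.setVar x j) else s.arr a j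
    have hloop : ∀ s₁, Inv 0 s₁ → (RProg.countLoop x (.seq (e.compile (h + 1))
        (.store 100 (.var x) (.var (h + 1))))).Runs s₁ (N * ((e.cost.eval N + 1 + 1) + 3) + 1)
          (Inv N) := by
      intro s₁ h₁
      refine RProg.runs_countLoop Inv ?_ ?_ h₁
      · intro i s' hi
        exact ⟨hi.2.2.1, by rw [hi.2.1 2 (by omega) hx2.symm, hs]⟩
      · rintro i s₂ - ⟨i1, i2, i3, i4, i5⟩
        refine (SumExpr.runs_compile he (h := h + 1) (by omega) (s := s₂)
          (by rw [i2 2 (by omega) hx2.symm, hs])).seq fun s₃ h₃ => RProg.runs_store ?_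
        obtain ⟨ha, hv, hr⟩ := h₃
        have hval : e.eval N s₂ = e.eval N (s.setVar x i) := by
          refine SumExpr.eval_congr N he ⟨fun y hy => ?_, fun a ha => by rw [i1 a ha]; rfl⟩
          by_cases hyx : y = x
          · simp [hyx, i3]
          · simp [hyx, i2 y (by omega) hyx]
        have hvx : s₃.var x = i := by rw [hv x (by omega), i3]
        refine ⟨fun b hb => ?_, fun y hy hyx => ?_, ?_, ?_, fun j hj => ?_⟩
        · funext j
          simp [show b ≠ 100 by omega, ha, i1 b hb]
        · simp [hyx, hv y (by omega), i2 y hy hyx]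
        · simp [hvx]
        · simp [show h ≠ x by omega, hv h (by omega), i4]
        · by_cases hji : j = i
          · simp [RExpr.eval, hvx, hji, hr, hval]
          · simp [RExpr.eval, hvx, hji, ha, i5 j (by omega)]
    have hloop' : ∀ s₁, Inv' 0 s₁ → (RProg.countLoop x
        (.store a (.var x) (.get 100 (.var x)))).Runs s₁ (N * (1 + 3) + 1) (Inv' N) := by
      intro s₁ h₁
      refine RProg.runs_countLoop Inv' ?_ ?_ h₁
      · intro i s' hi
        exact ⟨hi.2.2.1, by rw [hi.2.1 2 (by omega) hx2.symm, hs]⟩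
      · rintro i s₂ hiN ⟨i1, i2, i3, i4, i5, i6⟩
        refine RProg.runs_store ⟨fun b hb hba => ?_, fun y hy hyx => ?_, ?_, ?_,
          fun j hj => ?_, fun j => ?_⟩
        · funext j
          simp [hba, i1 b hb hba]
        · simp [hyx, i2 y hy hyx]
        · simp [i3]
        · simp [show h ≠ x by omega, i4]
        · simp [show (100 : ℕ) ≠ a by omega, i5 j hj]
        · by_cases hji : j = i
          · simp [RExpr.eval, i3, hji, i5 i hiN]
          · simp [RExpr.eval, i3, hji, i6 j, show j < i + 1 ↔ j < i by omega]
    refine ((RProg.runs_assign (Q := fun s' => s'.arr = s.arr ∧ (∀ y < h, s'.var y = s.var y) ∧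
        s'.var h = s.var x) ?_).seq fun s₁ h₁ =>
      ((RProg.runs_assign (Q := Inv 0) ?_).seq fun s₂ h₂ => ((hloop s₂ h₂).seq fun s₃ h₃ =>
      ((RProg.runs_assign (Q := Inv' 0) ?_).seq fun s₄ h₄ => ((hloop' s₄ h₄).seq fun s₅ h₅ =>
        RProg.runs_assign ?_))))).mono ?_ fun _ h => h
    · refine ⟨rfl, fun y hy => ?_, ?_⟩
      · simp [hy.ne]
      · simp [RExpr.eval]
    · refine ⟨fun b _ => by simp [h₁.1], fun y hy hyx => ?_, ?_, ?_, fun j hj => by omega⟩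
      · simp [h₁.2.1 y hy, hyx]
      · simp [RExpr.eval]
      · simp [h₁.2.2, show h ≠ x by omega]
    · obtain ⟨i1, i2, i3, i4, i5⟩ := h₃
      refine ⟨fun b hb _ => i1 b hb, fun y hy hyx => ?_, ?_, ?_, i5, fun j => ?_⟩
      · simp [hyx, i2 y hy hyx]
      · simp [RExpr.eval]
      · simp [i4, show h ≠ x by omega]
      · simp [i1 a ha]
    · obtain ⟨i1, i2, i3, i4, i5, i6⟩ := h₅
      refine ⟨⟨fun y hy => ?_, fun b hb => ?_⟩, fun y hy hy' => ?_⟩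
      · by_cases hyx : y = x
        · simp [hyx, RExpr.eval, i4, eval]
        · simp [hyx, i2 y (by omega) hyx, eval]
      · by_cases hba : b = a
        · subst hba
          funext j
          simp [eval, i6]
        · simp [eval, hba, i1 b hb hba]
      · simp [show y ≠ x by omega, i2 y hy (by omega)]
    · simp [cost]; ring_nf; omega

end SumStmt

/-! ## Region growing

Graphs are given by relations on `ℕ`; the vertices are the numbers below `n`. -/

open Classical in
/-- The neighbours of `B` in `U` outside `B`. -/
noncomputable def layer (adj : ℕ → ℕ → Prop) (U B : Finset ℕ) : Finset ℕ :=
  {x ∈ U | x ∉ B ∧ ∃ y ∈ B, adj y x}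

/-- Add the next layer to `B` if it is heavy compared with `B`. -/
noncomputable def grow (adj : ℕ → ℕ → Prop) (M : ℕ) (w : ℕ → ℕ) (U B : Finset ℕ) : Finset ℕ :=
  if ∑ x ∈ B, w x < M * ∑ x ∈ layer adj U B, w x then B ∪ layer adj U B else B

open Classical in
/-- The heaviest vertex of `U`, the first one in case of a tie. -/
noncomputable def heaviest (w : ℕ → ℕ) (U : Finset ℕ) : Finset ℕ :=
  {x ∈ U | ∀ u ∈ U, w u < w x ∨ (w u = w x ∧ x ≤ u)}

/-- The set grown from the heaviest vertex of `U` in `N` rounds. -/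
noncomputable def grownBall (adj : ℕ → ℕ → Prop) (M : ℕ) (w : ℕ → ℕ) (N : ℕ) (U : Finset ℕ) :
    Finset ℕ :=
  (grow adj M w U)^[N] (heaviest w U)

/-- Remove a grown ball and its last layer from the first set and add the layer to the second. -/
noncomputable def carve (adj : ℕ → ℕ → Prop) (M : ℕ) (w : ℕ → ℕ) (N : ℕ)
    (S : Finset ℕ × Finset ℕ) : Finset ℕ × Finset ℕ :=
  (S.1 \ (grownBall adj M w N S.1 ∪ layer adj S.1 (grownBall adj M w N S.1)),
    S.2 ∪ layer adj S.1 (grownBall adj M w N S.1))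

/-- The vertices that separate the clusters from each other. -/
noncomputable def boundary (adj : ℕ → ℕ → Prop) (M N n : ℕ) (w : ℕ → ℕ) : Finset ℕ :=
  ((carve adj M w N)^[N] (Finset.range n, ∅)).2

/-- Double the weights of the separating vertices. -/
noncomputable def reweight (adj : ℕ → ℕ → Prop) (M N n : ℕ) (w : ℕ → ℕ) : ℕ → ℕ :=
  fun x => if x ∈ boundary adj M N n w then w x + w x else w x

/-- The function `φ` changes by at most `D` along an edge. -/
def IsLip (adj : ℕ → ℕ → Prop) (D : ℕ) (φ : ℕ → ℤ) : Prop :=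
  ∀ x y, adj x y → |φ x - φ y| ≤ D

theorem heaviest_eq_singleton (w : ℕ → ℕ) {U : Finset ℕ} (hU : U.Nonempty) :
    ∃ v ∈ U, heaviest w U = {v} ∧ ∀ u ∈ U, w u ≤ w v := by
  classical
  obtain ⟨m, hm, hmax⟩ := U.exists_max_image w hU
  let S := U.filter fun x => w x = w m
  have hS : S.Nonempty := ⟨m, by simp [S, hm]⟩
  have hv := S.min'_mem hS
  set v := S.min' hS with hvdef
  simp only [S, Finset.mem_filter] at hv
  refine ⟨v, hv.1, ?_, fun u hu => hv.2 ▸ hmax u hu⟩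
  ext x
  simp only [heaviest, Finset.mem_filter, Finset.mem_singleton]
  constructor
  · rintro ⟨hx, h⟩
    rcases h v hv.1 with h1 | ⟨h1, h2⟩
    · have := hmax x hx; omega
    · have : v ≤ x := S.min'_le x (by simp [S, hx]; omega)
      omega
  · rintro rfl
    refine ⟨hv.1, fun u hu => ?_⟩
    rcases (hmax u hu).lt_or_eq with h | h
    · exact Or.inl (by omega)
    · exact Or.inr ⟨by omega, S.min'_le u (by simp [S, hu, h])⟩

theorem layer_subset (adj : ℕ → ℕ → Prop) (U B : Finset ℕ) : layer adj U B ⊆ U := by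
  classical exact fun x hx => (Finset.mem_filter.1 hx).1

theorem disjoint_layer (adj : ℕ → ℕ → Prop) (U B : Finset ℕ) : Disjoint B (layer adj U B) := by
  classical
  rw [Finset.disjoint_left]
  intro x hx h
  exact (Finset.mem_filter.1 h).2.1 hx

theorem grow_subset (adj : ℕ → ℕ → Prop) (M : ℕ) (w : ℕ → ℕ) {U B : Finset ℕ} (h : B ⊆ U) :
    grow adj M w U B ⊆ U := by
  unfold grow
  split_ifs
  · exact Finset.union_subset h (layer_subset _ _ _)
  · exact h

theorem subset_grow (adj : ℕ → ℕ → Prop) (M : ℕ) (w : ℕ → ℕ) (U B : Finset ℕ) :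
    B ⊆ grow adj M w U B := by
  unfold grow
  split_ifs
  · exact Finset.subset_union_left
  · exact subset_rfl

theorem two_mul_pow_le_succ_pow {M : ℕ} (hM : 1 ≤ M) : 2 * M ^ M ≤ (M + 1) ^ M := by
  have h0 : (0 : ℝ) < M := by exact_mod_cast hM
  have h1 : 2 ≤ (1 + 1 / (M : ℝ)) ^ M := by
    have h := one_add_mul_le_pow (a := 1 / (M : ℝ))
      ((by norm_num : (-2 : ℝ) ≤ 0).trans (by positivity)) M
    have h' : (M : ℝ) * (1 / M) = 1 := by field_simp
    linarith
  have h2 : 2 * (M : ℝ) ^ M ≤ ((M : ℝ) + 1) ^ M := by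
    have : (M : ℝ) + 1 = (1 + 1 / M) * M := by field_simp
    rw [this, mul_pow]
    gcongr
  exact_mod_cast h2

theorem succ_pow_le_four_mul_pow {M : ℕ} (hM : 1 ≤ M) : (M + 1) ^ M ≤ 4 * M ^ M := by
  have h0 : (0 : ℝ) < M := by exact_mod_cast hM
  have h1 : (1 + 1 / (M : ℝ)) ^ M ≤ 4 := by
    calc (1 + 1 / (M : ℝ)) ^ M ≤ (Real.exp (1 / M)) ^ M := by
          gcongr
          rw [add_comm]; exact Real.add_one_le_exp _
      _ = Real.exp 1 := by rw [← Real.exp_nat_mul]; congr 1; field_simp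
      _ ≤ 4 := by linarith [Real.exp_one_lt_d9]
  have h2 : ((M : ℝ) + 1) ^ M ≤ 4 * (M : ℝ) ^ M := by
    have : (M : ℝ) + 1 = (1 + 1 / M) * M := by field_simp
    rw [this, mul_pow]
    gcongr
  exact_mod_cast h2

theorem lt_of_succ_pow_lt {M l r : ℕ} (hM : 1 ≤ M) (h : (M + 1) ^ r < 2 ^ l * M ^ r) :
    r < M * l := by
  by_contra hr
  push Not at hr
  obtain ⟨j, rfl⟩ := Nat.exists_eq_add_of_le hr
  have h1 : 2 ^ l * M ^ (M * l) ≤ (M + 1) ^ (M * l) := by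
    rw [pow_mul, pow_mul, ← mul_pow]
    exact Nat.pow_le_pow_left (two_mul_pow_le_succ_pow hM) l
  have h2 : M ^ j ≤ (M + 1) ^ j := Nat.pow_le_pow_left (by omega) j
  rw [pow_add, pow_add, ← mul_assoc] at h
  exact absurd (Nat.mul_le_mul h1 h2) (by omega)

theorem grow_iterate {adj : ℕ → ℕ → Prop} {M : ℕ} {w : ℕ → ℕ} {U : Finset ℕ} {v : ℕ}
    (hv : heaviest w U = {v}) (r : ℕ) :
    ∃ r' ≤ r, (M + 1) ^ r' * w v ≤ M ^ r' * ∑ x ∈ (grow adj M w U)^[r] (heaviest w U), w x ∧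
      (∀ D φ, IsLip adj D φ →
        ∀ x ∈ (grow adj M w U)^[r] (heaviest w U), |φ x - φ v| ≤ D * (r' : ℤ)) ∧
      (r' = r ∨ M * ∑ x ∈ layer adj U ((grow adj M w U)^[r] (heaviest w U)), w x ≤
        ∑ x ∈ (grow adj M w U)^[r] (heaviest w U), w x) := by
  induction r with
  | zero =>
    refine ⟨0, le_rfl, by simp [hv], fun D φ _ x hx => ?_, Or.inl rfl⟩
    simp only [Function.iterate_zero, id_eq, hv, Finset.mem_singleton] at hx
    simp [hx]
  | succ r ih =>
    obtain ⟨r', hr', hw, hφ, hhalt⟩ := ih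
    rw [Function.iterate_succ_apply']
    set B := (grow adj M w U)^[r] (heaviest w U)
    by_cases h : ∑ x ∈ B, w x < M * ∑ x ∈ layer adj U B, w x
    · obtain rfl : r' = r := by
        rcases hhalt with h' | h'
        · exact h'
        · omega
      have hg : grow adj M w U B = B ∪ layer adj U B := if_pos h
      refine ⟨r' + 1, le_rfl, ?_, fun D φ hφ' x hx => ?_, Or.inl rfl⟩
      · rw [hg, Finset.sum_union (disjoint_layer _ _ _)]
        calc (M + 1) ^ (r' + 1) * w v = (M + 1) * ((M + 1) ^ r' * w v) := by ring
          _ ≤ (M + 1) * (M ^ r' * ∑ x ∈ B, w x) := Nat.mul_le_mul_left _ hw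
          _ = M ^ r' * (M * ∑ x ∈ B, w x + ∑ x ∈ B, w x) := by ring
          _ ≤ M ^ r' * (M * ∑ x ∈ B, w x + M * ∑ x ∈ layer adj U B, w x) := by gcongr
          _ = _ := by ring
      · rw [hg, Finset.mem_union] at hx
        rcases hx with hx | hx
        · refine (hφ D φ hφ' x hx).trans ?_
          push_cast
          nlinarith
        · classical
          obtain ⟨-, -, y, hy, hyx⟩ := Finset.mem_filter.1 hx
          have h1 := hφ D φ hφ' y hy
          have h2 := hφ' y x hyx
          rw [abs_le] at h1 h2 ⊢
          push_cast
          constructor <;> linarith [h1.1, h1.2, h2.1, h2.2]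
    · have hg : grow adj M w U B = B := if_neg h
      rw [hg]
      exact ⟨r', by omega, hw, hφ, Or.inr (by omega)⟩

theorem grow_iterate_subset (adj : ℕ → ℕ → Prop) (M : ℕ) (w : ℕ → ℕ) (U : Finset ℕ) (r : ℕ) :
    (grow adj M w U)^[r] (heaviest w U) ⊆ U := by
  induction r with
  | zero => exact Finset.filter_subset _ _
  | succ r ih => rw [Function.iterate_succ_apply']; exact grow_subset _ _ _ ih

theorem heaviest_subset_grow_iterate (adj : ℕ → ℕ → Prop) (M : ℕ) (w : ℕ → ℕ) (U : Finset ℕ)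
    (r : ℕ) : heaviest w U ⊆ (grow adj M w U)^[r] (heaviest w U) := by
  induction r with
  | zero => exact subset_rfl
  | succ r ih => rw [Function.iterate_succ_apply']; exact ih.trans (subset_grow _ _ _ _ _)

theorem grownBall_spec {adj : ℕ → ℕ → Prop} {M N n l : ℕ} {w : ℕ → ℕ} {U : Finset ℕ}
    (hU : U.Nonempty) (hUn : U ⊆ Finset.range n) (hw : ∀ x, 0 < w x) (hM : 1 ≤ M)
    (hl : n < 2 ^ l) (hN : M * l ≤ N) :
    ∃ v ∈ U, v ∈ grownBall adj M w N U ∧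
      M * ∑ x ∈ layer adj U (grownBall adj M w N U), w x ≤ ∑ x ∈ grownBall adj M w N U, w x ∧
      ∀ D φ, IsLip adj D φ → ∀ x ∈ grownBall adj M w N U, |φ x - φ v| ≤ D * (M * l : ℕ) := by
  obtain ⟨v, hvU, hv, hmax⟩ := heaviest_eq_singleton w hU
  obtain ⟨r, hr, hgrow, hφ, hhalt⟩ := grow_iterate (adj := adj) (M := M) hv N
  have hsub := grow_iterate_subset adj M w U N
  have hle : ∑ x ∈ (grow adj M w U)^[N] (heaviest w U), w x ≤ n * w v := by
    calc _ ≤ ∑ x ∈ U, w x := Finset.sum_le_sum_of_subset hsub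
      _ ≤ U.card * w v := by simpa using Finset.sum_le_card_nsmul U w (w v) hmax
      _ ≤ n * w v := by
        gcongr
        simpa using Finset.card_le_card hUn
  have hlt : r < M * l := by
    refine lt_of_succ_pow_lt hM ?_
    have h1 : (M + 1) ^ r * w v ≤ M ^ r * n * w v := by
      rw [mul_assoc]; exact hgrow.trans (Nat.mul_le_mul_left _ hle)
    have h2 := Nat.le_of_mul_le_mul_right h1 (hw v)
    have h3 : 0 < M ^ r := by positivity
    nlinarith
  refine ⟨v, hvU, ?_, ?_, fun D φ h x hx => (hφ D φ h x hx).trans ?_⟩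
  · exact heaviest_subset_grow_iterate adj M w U N (by simp [hv])
  · rcases hhalt with h | h
    · omega
    · exact h
  · have : (r : ℤ) ≤ (M * l : ℕ) := by exact_mod_cast hlt.le
    gcongr

/-- A partial clustering: `S.1` are the unassigned and `S.2` the separating vertices; the remaining
vertices carry the centre of their cluster. -/
structure IsClustering (adj : ℕ → ℕ → Prop) (n M R : ℕ) (w : ℕ → ℕ) (S : Finset ℕ × Finset ℕ)
    (c : ℕ → ℕ) : Prop where
  subset : S.1 ∪ S.2 ⊆ Finset.range n
  disjoint : Disjoint S.1 S.2
  weight : M * ∑ x ∈ S.2, w x ≤ ∑ x ∈ Finset.range n \ (S.1 ∪ S.2), w x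
  lt : ∀ x ∈ Finset.range n \ (S.1 ∪ S.2), c x < n
  near : ∀ x ∈ Finset.range n \ (S.1 ∪ S.2), ∀ D φ, IsLip adj D φ → |φ x - φ (c x)| ≤ D * (R : ℤ)
  same : ∀ x ∈ Finset.range n \ (S.1 ∪ S.2), ∀ y ∈ Finset.range n \ (S.1 ∪ S.2),
    adj x y → c x = c y
  apart : ∀ x ∈ Finset.range n \ (S.1 ∪ S.2), ∀ y ∈ S.1, ¬ adj x y

theorem carve_empty (adj : ℕ → ℕ → Prop) (M : ℕ) (w : ℕ → ℕ) (N : ℕ) (E : Finset ℕ) :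
    carve adj M w N (∅, E) = (∅, E) := by
  have h : layer adj ∅ (grownBall adj M w N ∅) = ∅ := Finset.subset_empty.1 (layer_subset _ _ _)
  simp [carve, h]

theorem IsClustering.carve {adj : ℕ → ℕ → Prop} (hadj : ∀ x y, adj x y → adj y x)
    {n M N l : ℕ} {w : ℕ → ℕ} {S : Finset ℕ × Finset ℕ} {c : ℕ → ℕ}
    (hw : ∀ x, 0 < w x) (hM : 1 ≤ M) (hl : n < 2 ^ l) (hN : M * l ≤ N)
    (h : IsClustering adj n M (M * l) w S c) :
    (∃ c', IsClustering adj n M (M * l) w (carve adj M w N S) c') ∧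
      (carve adj M w N S).1.card ≤ S.1.card - 1 := by
  obtain ⟨U, E⟩ := S
  rcases U.eq_empty_or_nonempty with rfl | hU
  · rw [carve_empty]; exact ⟨⟨c, h⟩, by simp⟩
  have hsub : U ∪ E ⊆ Finset.range n := h.subset
  obtain ⟨v, hvU, hvB, hweight, hnear⟩ := grownBall_spec (adj := adj) hU
    (Finset.union_subset_left hsub) hw hM hl hN
  have hBU : grownBall adj M w N U ⊆ U := grow_iterate_subset adj M w U N
  unfold _root_.carve
  dsimp only
  set B := grownBall adj M w N U
  set L := layer adj U B with hL
  have hLU : L ⊆ U := layer_subset _ _ _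
  have hBL : Disjoint B L := disjoint_layer _ _ _
  have hUE : Disjoint U E := h.disjoint
  have hrest : Finset.range n \ (U \ (B ∪ L) ∪ (E ∪ L)) = (Finset.range n \ (U ∪ E)) ∪ B := by
    ext x
    have h1 : x ∈ B → x ∈ U := fun hx => hBU hx
    have h2 : x ∈ L → x ∈ U := fun hx => hLU hx
    have h3 : x ∈ U → x ∈ Finset.range n := fun hx => hsub (Finset.mem_union_left _ hx)
    have h4 : x ∈ U → x ∉ E := fun hx hx' => Finset.disjoint_left.1 hUE hx hx'
    have h5 : x ∈ B → x ∉ L := fun hx hx' => Finset.disjoint_left.1 hBL hx hx'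
    simp only [Finset.mem_sdiff, Finset.mem_union]
    tauto
  have hdisj : Disjoint (Finset.range n \ (U ∪ E)) B := by
    rw [Finset.disjoint_left]
    intro x hx hxB
    simp only [Finset.mem_sdiff, Finset.mem_union, not_or] at hx
    exact hx.2.1 (hBU hxB)
  classical
  have hBadj : ∀ x ∈ B, ∀ y ∈ U, adj x y → y ∈ B ∪ L := by
    intro x hx y hy hxy
    by_cases hyB : y ∈ B
    · exact Finset.mem_union_left _ hyB
    · exact Finset.mem_union_right _ (Finset.mem_filter.2 ⟨hy, hyB, x, hx, hxy⟩)
  refine ⟨⟨fun x => if x ∈ B then v else c x, ?_⟩, ?_⟩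
  · constructor
    · refine Finset.union_subset ?_ (Finset.union_subset ?_ ?_)
      · exact Finset.sdiff_subset.trans (Finset.union_subset_left hsub)
      · exact Finset.union_subset_right hsub
      · exact hLU.trans (Finset.union_subset_left hsub)
    · rw [Finset.disjoint_left]
      intro x hx hx'
      simp only [Finset.mem_sdiff, Finset.mem_union, not_or] at hx hx'
      rcases hx' with hx' | hx'
      · exact Finset.disjoint_left.1 hUE hx.1 hx'
      · exact hx.2.2 hx'
    · dsimp only
      rw [hrest, Finset.sum_union hdisj, Finset.sum_union (hUE.symm.mono_right hLU), mul_add]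
      exact Nat.add_le_add h.weight hweight
    · dsimp only
      rw [hrest]
      intro x hx
      split_ifs with hxB
      · exact Finset.mem_range.1 (hsub (Finset.mem_union_left _ hvU))
      · exact h.lt x ((Finset.mem_union.1 hx).resolve_right hxB)
    · dsimp only
      rw [hrest]
      intro x hx D φ hφ
      split_ifs with hxB
      · exact hnear D φ hφ x hxB
      · exact h.near x ((Finset.mem_union.1 hx).resolve_right hxB) D φ hφ
    · dsimp only
      rw [hrest]
      intro x hx y hy hxy
      by_cases hxB : x ∈ B <;> by_cases hyB : y ∈ B
      · simp [hxB, hyB]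
      · exact absurd (hadj x y hxy)
          (h.apart y ((Finset.mem_union.1 hy).resolve_right hyB) x (hBU hxB))
      · exact absurd hxy (h.apart x ((Finset.mem_union.1 hx).resolve_right hxB) y (hBU hyB))
      · simpa [hxB, hyB] using h.same x ((Finset.mem_union.1 hx).resolve_right hxB) y
          ((Finset.mem_union.1 hy).resolve_right hyB) hxy
    · dsimp only
      rw [hrest]
      intro x hx y hy hxy
      rw [Finset.mem_sdiff] at hy
      rcases Finset.mem_union.1 hx with hx | hx
      · exact h.apart x hx y hy.1 hxy
      · exact hy.2 (hBadj x hx y hy.1 hxy)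
  · have : U \ (B ∪ L) ⊆ U.erase v := by
      intro x hx
      rw [Finset.mem_sdiff, Finset.mem_union, not_or] at hx
      exact Finset.mem_erase.2 ⟨fun hxv => hx.2.1 (hxv ▸ hvB), hx.1⟩
    simpa [Finset.card_erase_of_mem hvU] using Finset.card_le_card this

theorem exists_isClustering_boundary {adj : ℕ → ℕ → Prop} (hadj : ∀ x y, adj x y → adj y x)
    {n M N l : ℕ} {w : ℕ → ℕ} (hw : ∀ x, 0 < w x) (hM : 1 ≤ M) (hl : n < 2 ^ l)
    (hN : M * l ≤ N) (hn : n ≤ N) :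
    ∃ c, IsClustering adj n M (M * l) w (∅, boundary adj M N n w) c := by
  have key : ∀ j, (∃ c, IsClustering adj n M (M * l) w
      ((_root_.carve adj M w N)^[j] (Finset.range n, ∅)) c) ∧
      ((_root_.carve adj M w N)^[j] (Finset.range n, ∅)).1.card ≤ n - j := by
    intro j
    induction j with
    | zero =>
      refine ⟨⟨id, ?_⟩, by simp⟩
      constructor <;> simp
    | succ j ih =>
      obtain ⟨⟨c, hc⟩, hcard⟩ := ih
      rw [Function.iterate_succ_apply']
      obtain ⟨h1, h2⟩ := hc.carve hadj hw hM hl hN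
      exact ⟨h1, h2.trans (by omega)⟩
  obtain ⟨⟨c, hc⟩, hcard⟩ := key N
  have h0 : ((_root_.carve adj M w N)^[N] (Finset.range n, ∅)).1 = ∅ := by
    rw [← Finset.card_eq_zero]; omega
  refine ⟨c, ?_⟩
  have : ((_root_.carve adj M w N)^[N] (Finset.range n, ∅)) = (∅, boundary adj M N n w) :=
    Prod.ext h0 rfl
  rwa [this] at hc

/-! ## Multiplicative weights -/

section weights

variable {adj : ℕ → ℕ → Prop} {n M N l : ℕ}

theorem reweight_iterate_eq (t x : ℕ) :
    (reweight adj M N n)^[t] (fun _ => 1) x =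
      2 ^ ({i ∈ Finset.range t | x ∈ boundary adj M N n ((reweight adj M N n)^[i] fun _ => 1)}).card
        := by
  induction t with
  | zero => simp
  | succ t ih =>
    rw [Function.iterate_succ_apply', Finset.range_add_one, Finset.filter_insert]
    unfold reweight at ih ⊢
    split_ifs with h
    · rw [Finset.card_insert_of_notMem (by simp), ih]; ring
    · exact ih

theorem sum_reweight_le (hadj : ∀ x y, adj x y → adj y x) {w : ℕ → ℕ} (hw : ∀ x, 0 < w x)
    (hM : 1 ≤ M) (hl : n < 2 ^ l) (hN : M * l ≤ N) (hn : n ≤ N) :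
    M * ∑ x ∈ Finset.range n, reweight adj M N n w x ≤ (M + 1) * ∑ x ∈ Finset.range n, w x := by
  obtain ⟨c, hc⟩ := exists_isClustering_boundary hadj hw hM hl hN hn
  have hsub : boundary adj M N n w ⊆ Finset.range n := by simpa using hc.subset
  have h1 : ∀ x, reweight adj M N n w x = w x + if x ∈ boundary adj M N n w then w x else 0 := by
    intro x
    unfold reweight
    split_ifs <;> simp
  have h2 := hc.weight
  simp only [Finset.empty_union] at h2
  have h3 : ∑ x ∈ Finset.range n \ boundary adj M N n w, w x ≤ ∑ x ∈ Finset.range n, w x :=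
    Finset.sum_le_sum_of_subset Finset.sdiff_subset
  simp only [h1, Finset.sum_add_distrib]
  rw [← Finset.sum_filter, Finset.filter_mem_eq_inter, Finset.inter_eq_right.2 hsub, mul_add,
    add_mul, one_mul]
  omega

theorem reweight_iterate_pos (t x : ℕ) : 0 < (reweight adj M N n)^[t] (fun _ => 1) x := by
  rw [reweight_iterate_eq]; positivity

/-- For every set `X` of vertices, one of the first `M * l` rounds separates only few vertices of
`X` from their clusters. -/
theorem exists_round (hadj : ∀ x y, adj x y → adj y x) (hM : 1 ≤ M) (hl0 : 1 ≤ l)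
    (hl : n < 2 ^ l) (hN : M * l ≤ N) (hn : n ≤ N) {X : Finset ℕ} (hX : X ⊆ Finset.range n) :
    ∃ t < M * l, M * (X ∩ boundary adj M N n ((reweight adj M N n)^[t] fun _ => 1)).card ≤
      3 * X.card := by
  set W : ℕ → ℕ → ℕ := fun t => (reweight adj M N n)^[t] fun _ => 1
  have hsum : ∀ t, M ^ t * ∑ x ∈ Finset.range n, W t x ≤ (M + 1) ^ t * n := by
    intro t
    induction t with
    | zero => simp [W]
    | succ t ih =>
      have h := sum_reweight_le hadj (w := W t) (reweight_iterate_pos t) hM hl hN hn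
      have h' : W (t + 1) = reweight adj M N n (W t) := Function.iterate_succ_apply' _ _ _
      rw [h']
      calc _ = M ^ t * (M * ∑ x ∈ Finset.range n, reweight adj M N n (W t) x) := by ring
        _ ≤ M ^ t * ((M + 1) * ∑ x ∈ Finset.range n, W t x) := Nat.mul_le_mul_left _ h
        _ = (M + 1) * (M ^ t * ∑ x ∈ Finset.range n, W t x) := by ring
        _ ≤ (M + 1) * ((M + 1) ^ t * n) := Nat.mul_le_mul_left _ ih
        _ = _ := by ring
  have hcount : ∀ x ∈ X, ({i ∈ Finset.range (M * l) | x ∈ boundary adj M N n (W i)}).card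
      ≤ 3 * l := by
    intro x hx
    have h1 : W (M * l) x ≤ ∑ x ∈ Finset.range n, W (M * l) x :=
      Finset.single_le_sum (f := W (M * l)) (fun _ _ => Nat.zero_le _) (hX hx)
    have h2 := (Nat.mul_le_mul_left _ h1).trans (hsum (M * l))
    have h3 : (M + 1) ^ (M * l) ≤ M ^ (M * l) * 4 ^ l := by
      rw [pow_mul, pow_mul, ← mul_pow, mul_comm]
      exact Nat.pow_le_pow_left (succ_pow_le_four_mul_pow hM) l
    have h4 : M ^ (M * l) * W (M * l) x ≤ M ^ (M * l) * (4 ^ l * 2 ^ l) := by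
      calc _ ≤ (M + 1) ^ (M * l) * n := h2
        _ ≤ (M ^ (M * l) * 4 ^ l) * 2 ^ l := Nat.mul_le_mul h3 hl.le
        _ = _ := by ring
    have h5 := Nat.le_of_mul_le_mul_left h4 (by positivity)
    rw [show W (M * l) x = _ from reweight_iterate_eq _ _, ← mul_pow,
      show 4 * 2 = 2 ^ 3 by norm_num, ← pow_mul] at h5
    exact (Nat.pow_le_pow_iff_right (by norm_num)).1 h5
  by_contra! hcon
  have hT : 0 < M * l := by positivity
  have hdouble : ∑ i ∈ Finset.range (M * l), (X ∩ boundary adj M N n (W i)).card =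
      ∑ x ∈ X, ({i ∈ Finset.range (M * l) | x ∈ boundary adj M N n (W i)}).card := by
    simp only [Finset.card_filter, ← Finset.filter_mem_eq_inter]
    exact Finset.sum_comm
  have h1 : ∑ x ∈ X, ({i ∈ Finset.range (M * l) | x ∈ boundary adj M N n (W i)}).card ≤
      X.card * (3 * l) := by simpa using Finset.sum_le_card_nsmul X _ _ hcount
  have h2 : M * l * (3 * X.card) <
      ∑ i ∈ Finset.range (M * l), M * (X ∩ boundary adj M N n (W i)).card := by
    have := Finset.sum_lt_sum_of_nonempty (s := Finset.range (M * l)) (by simpa using hT.ne')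
      fun i hi => hcon i (Finset.mem_range.1 hi)
    simpa using this
  rw [← Finset.mul_sum, hdouble] at h2
  have h3 := Nat.mul_le_mul_left M h1
  have : M * (X.card * (3 * l)) = M * l * (3 * X.card) := by ring
  omega

end weights

/-! ## Path decompositions -/

theorem isTree_pathGraph (m : ℕ) : (SimpleGraph.pathGraph (m + 1)).IsTree := by
  rw [SimpleGraph.isTree_iff_connected_and_card]
  refine ⟨SimpleGraph.pathGraph_connected m, ?_⟩
  have e : Nat.card (SimpleGraph.pathGraph (m + 1)).edgeSet = Nat.card (Fin m) := by
    refine (Nat.card_congr (Equiv.ofBijective (fun i : Fin m =>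
      (⟨s(i.castSucc, i.succ), by simp [SimpleGraph.pathGraph_adj]⟩ :
        (SimpleGraph.pathGraph (m + 1)).edgeSet)) ⟨?_, ?_⟩)).symm
    · intro i j hij
      simp only [Subtype.mk.injEq, Sym2.eq_iff, Fin.ext_iff, Fin.val_castSucc, Fin.val_succ] at hij
      ext; omega
    · rintro ⟨e, he⟩
      induction e with
      | _ u v =>
        rw [SimpleGraph.mem_edgeSet, SimpleGraph.pathGraph_adj] at he
        rcases he with h | h
        · exact ⟨⟨u, by omega⟩, Subtype.ext (Sym2.eq_iff.2 (Or.inl ⟨Fin.ext rfl, Fin.ext h⟩))⟩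
        · exact ⟨⟨v, by omega⟩, Subtype.ext (Sym2.eq_iff.2 (Or.inr ⟨Fin.ext rfl, Fin.ext h⟩))⟩
  simp [e]

theorem preconnected_induce_pathGraph (m a b : ℕ) :
    ((SimpleGraph.pathGraph m).induce {t | a ≤ t.val ∧ t.val ≤ b}).Preconnected := by
  have key : ∀ j (s t : {t : Fin m | a ≤ t.val ∧ t.val ≤ b}), s.1.val + j = t.1.val →
      ((SimpleGraph.pathGraph m).induce {t | a ≤ t.val ∧ t.val ≤ b}).Reachable s t := by
    intro j
    induction j with
    | zero =>
      intro s t h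
      have : s = t := Subtype.ext (Fin.ext (by simpa using h))
      rw [this]
    | succ j ih =>
      intro s t h
      have hs := s.2
      have ht := t.2
      simp only [Set.mem_ofPred_eq] at hs ht
      let u : {t : Fin m | a ≤ t.val ∧ t.val ≤ b} :=
        ⟨⟨s.1.val + j, by omega⟩, by simp only [Set.mem_ofPred_eq]; omega⟩
      refine (ih s u rfl).trans (SimpleGraph.Adj.reachable ?_)
      rw [SimpleGraph.comap_adj, Function.Embedding.subtype_apply, Function.Embedding.subtype_apply,
        SimpleGraph.pathGraph_adj]
      exact Or.inl (by simp only [u]; omega)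
  intro s t
  rcases le_total s.1.val t.1.val with h | h
  · exact key _ s t (Nat.add_sub_of_le h)
  · exact (key _ t s (Nat.add_sub_of_le h)).symm

theorem treewidth_le_of_intervals {V : Type*} [Fintype V] (G : SimpleGraph V) (a b : V → ℕ)
    (hab : ∀ v, a v ≤ b v) (hadj : ∀ u v, G.Adj u v → a u ≤ b v) {w : ℕ}
    (hw : ∀ i, ({v | a v ≤ i ∧ i ≤ b v} : Finset V).card ≤ w + 1) : treewidth G ≤ w := by
  let m := Finset.univ.sup b
  have hm : ∀ v, b v ≤ m := fun v => Finset.le_sup (Finset.mem_univ v)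
  have hv : ∀ v, a v < m + 1 := fun v => by have := hab v; have := hm v; omega
  refine Nat.sInf_le ⟨{
    Node := Fin (m + 1)
    finite_node := inferInstance
    tree := SimpleGraph.pathGraph (m + 1)
    isTree := isTree_pathGraph m
    bag := fun t => {v | a v ≤ t.val ∧ t.val ≤ b v}
    covers := fun v => ⟨⟨a v, hv v⟩, by simp [hab v]⟩
    covers_edge := fun u v h => ⟨⟨max (a u) (a v), max_lt (hv u) (hv v)⟩, by
      simp [hab, hadj u v h, hadj v u h.symm]⟩
    connected := fun v => by
      have h : {t : Fin (m + 1) | v ∈ ({v | a v ≤ t.val ∧ t.val ≤ b v} : Finset V)} =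
          {t | a v ≤ t.val ∧ t.val ≤ b v} := by ext; simp
      rw [h]
      exact preconnected_induce_pathGraph (m + 1) (a v) (b v) }, fun t => hw t⟩

/-! ## Graphs with a grid labelling -/

/-- The relation on `ℕ` given by the edges of a graph on `Fin n`. -/
def natAdj {n : ℕ} (G : SimpleGraph (Fin n)) (x y : ℕ) : Prop :=
  ∃ u v : Fin n, x = u ∧ y = v ∧ G.Adj u v

theorem natAdj_symm {n : ℕ} (G : SimpleGraph (Fin n)) (x y : ℕ) (h : natAdj G x y) :
    natAdj G y x := by
  obtain ⟨u, v, hu, hv, h⟩ := h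
  exact ⟨v, u, hv, hu, h.symm⟩

/-- A labelling of the vertices by points of the grid `ℤ^d` that changes every coordinate by at
most `D` along an edge and takes every value at most `F` times. -/
structure IsGridLabelling {V : Type*} [Fintype V] {d : ℕ} (G : SimpleGraph V) (D F : ℕ)
    (g : V → Fin d → ℤ) : Prop where
  lip : ∀ u v, G.Adj u v → ∀ i, |g u i - g v i| ≤ D
  fiber : ∀ z, ({v | g v = z} : Finset V).card ≤ F

namespace IsGridLabelling

theorem card_le {V : Type*} [Fintype V] {d : ℕ} {G : SimpleGraph V} {D F : ℕ} {g : V → Fin d → ℤ}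
    (hg : IsGridLabelling G D F g) (s : Finset V) (lo : Fin d → ℤ) (len : Fin d → ℕ)
    (h : ∀ v ∈ s, ∀ i, lo i ≤ g v i ∧ g v i < lo i + len i) : s.card ≤ F * ∏ i, len i := by
  classical
  have hbox : (Fintype.piFinset fun i => Finset.Ico (lo i) (lo i + len i)).card = ∏ i, len i := by
    simp [Fintype.card_piFinset]
  rw [← hbox]
  refine Finset.card_le_mul_card_image_of_maps_to (f := g) ?_ F ?_
  · intro v hv
    simp only [Fintype.mem_piFinset, Finset.mem_Ico]
    exact h v hv
  · intro z _
    exact (Finset.card_le_card (Finset.filter_subset_filter _ (Finset.subset_univ s))).trans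
      (hg.fiber z)

theorem abs_sub_le_walk {V : Type*} [Fintype V] {d : ℕ} {G : SimpleGraph V} {D F : ℕ}
    {g : V → Fin d → ℤ} (hg : IsGridLabelling G D F g) {u v : V} (p : G.Walk u v) (i : Fin d) :
    |g u i - g v i| ≤ D * (p.length : ℤ) := by
  induction p with
  | nil => simp
  | cons h p ih =>
    have h1 := hg.lip _ _ h i
    rw [abs_le] at h1 ih ⊢
    rw [SimpleGraph.Walk.length_cons]
    push_cast
    constructor <;> linarith [h1.1, h1.2, ih.1, ih.2]

theorem card_le_of_radius_le {V : Type*} [Fintype V] {d : ℕ} {G : SimpleGraph V} {D F : ℕ}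
    {g : V → Fin d → ℤ} (hg : IsGridLabelling G D F g) (hG : G.Connected) {r : ℕ}
    (hr : G.radius ≤ r) : Fintype.card V ≤ F * (2 * D * r + 1) ^ d := by
  have := hG.nonempty
  obtain ⟨u, hu⟩ := G.exists_eccent_eq_radius
  have h := hg.card_le Finset.univ (fun i => g u i - D * r) (fun _ => 2 * D * r + 1) ?_
  · simpa using h
  · intro v _ i
    obtain ⟨p, hp⟩ := hG.exists_walk_length_eq_edist u v
    have h1 : (p.length : ℕ∞) ≤ r := by
      rw [hp]; exact SimpleGraph.edist_le_eccent.trans (hu.le.trans hr)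
    have h2 : p.length ≤ r := by exact_mod_cast h1
    have h3 := hg.abs_sub_le_walk p i
    have h4 : (D : ℤ) * p.length ≤ D * r := by
      gcongr
    rw [abs_le] at h3
    push_cast
    constructor <;> linarith [h3.1, h3.2]

/-- If all vertices of `A` outside `S` lie in clusters of radius at most `R`, then a sweep along
the first coordinate through one cluster after the other is a path decomposition of small width. -/
theorem treewidth_induce_le {n d : ℕ} {G : SimpleGraph (Fin n)} {D F : ℕ}
    {g : Fin n → Fin (d + 1) → ℤ} (hg : IsGridLabelling G D F g) {M R : ℕ} {w : ℕ → ℕ}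
    {E : Finset ℕ} {c : ℕ → ℕ} (hc : IsClustering (natAdj G) n M R w (∅, E) c) (S : Finset ℕ)
    {A : Set (Fin n)} (hA : ∀ v ∈ A, (v : ℕ) ∉ E ∨ (v : ℕ) ∈ S) :
    treewidth (G.induce A) ≤ S.card + F * ((D + 1) * (2 * D * R + 1) ^ d) := by
  classical
  let φ : Fin (d + 1) → ℕ → ℤ := fun i x => if h : x < n then g ⟨x, h⟩ i else 0
  have hφ : ∀ (i) (v : Fin n), φ i v = g v i := fun i v => by simp [φ]
  have hlip : ∀ i, IsLip (natAdj G) D (φ i) := by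
    rintro i _ _ ⟨u, v, rfl, rfl, h⟩
    rw [hφ, hφ]
    exact hg.lip u v h i
  have hmem : ∀ v ∈ A, (v : ℕ) ∉ S → (v : ℕ) ∈ Finset.range n \ (∅ ∪ E) := by
    intro v hv hS
    simpa using (hA v hv).resolve_right hS
  let B : ℤ := ∑ v, |g v 0|
  have hB : ∀ v, 0 ≤ g v 0 + B ∧ g v 0 + B ≤ 2 * B := by
    intro v
    have h := Finset.single_le_sum (f := fun v => |g v 0|) (fun _ _ => abs_nonneg _)
      (Finset.mem_univ v)
    have h' := neg_abs_le (g v 0)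
    have h'' := le_abs_self (g v 0)
    constructor <;> simp only [B] <;> linarith
  let H : ℕ := (2 * B).toNat + D + 1
  let p : Fin n → ℕ := fun v => (g v 0 + B).toNat
  have hp : ∀ v, (p v : ℤ) = g v 0 + B := fun v => Int.toNat_of_nonneg (hB v).1
  have hpH : ∀ v, p v + D < H := by
    intro v
    have := hp v
    have := hB v
    simp only [H]
    omega
  let a : A → ℕ := fun v => if (v.1 : ℕ) ∈ S then 0 else c v.1 * H + p v.1
  let b : A → ℕ := fun v => if (v.1 : ℕ) ∈ S then n * H else c v.1 * H + p v.1 + D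
  have hcn : ∀ v ∈ A, (v : ℕ) ∉ S → c v * H + H ≤ n * H := by
    intro v hv hS
    have := hc.lt v (hmem v hv hS)
    calc c v * H + H = (c v + 1) * H := by ring
      _ ≤ n * H := Nat.mul_le_mul_right _ this
  refine treewidth_le_of_intervals (G.induce A) a b ?_ ?_ ?_
  · intro v
    simp only [a, b]
    split_ifs <;> omega
  · intro u v huv
    have hadj : G.Adj u.1 v.1 := huv
    have h1 := hpH u.1
    simp only [a, b]
    by_cases hu : (u.1 : ℕ) ∈ S <;> by_cases hv : (v.1 : ℕ) ∈ S
    · simp [hu, hv]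
    · simp [hu, hv]
    · simp only [hu, hv, if_true, if_false]
      have := hcn u.1 u.2 hu
      omega
    · simp only [hu, hv, if_false]
      rw [hc.same u.1 (hmem _ u.2 hu) v.1 (hmem _ v.2 hv) ⟨u.1, v.1, rfl, rfl, hadj⟩]
      have h2 := abs_le.1 (hg.lip _ _ hadj 0)
      have h3 := hp u.1
      have h4 := hp v.1
      omega
  · intro i
    let j := i / H
    have hcard : (({v | a v ≤ i ∧ i ≤ b v} : Finset A).map (Function.Embedding.subtype _)).card ≤
        S.card + F * ((D + 1) * (2 * D * R + 1) ^ d) := by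
      let P : Finset (Fin n) := Finset.univ.filter fun v => (v : ℕ) ∈ S
      let Q : Finset (Fin n) := Finset.univ.filter fun v => v ∈ A ∧ (v : ℕ) ∉ S ∧
        c v * H + p v ≤ i ∧ i ≤ c v * H + p v + D
      have hsub : ({v | a v ≤ i ∧ i ≤ b v} : Finset A).map (Function.Embedding.subtype _) ⊆
          P ∪ Q := by
        intro v hv
        simp only [Finset.mem_map, Finset.mem_filter, Finset.mem_univ, true_and,
          Function.Embedding.subtype_apply, Subtype.exists, exists_and_right, exists_eq_right] at hv
        obtain ⟨hvA, hv⟩ := hv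
        simp only [P, Q, Finset.mem_union, Finset.mem_filter, Finset.mem_univ, true_and]
        by_cases hS : (v : ℕ) ∈ S
        · exact Or.inl hS
        · simp only [a, b, hS, if_false] at hv
          exact Or.inr ⟨hvA, hS, hv⟩
      have hP : P.card ≤ S.card := by
        refine Finset.card_le_card_of_injOn (fun v => (v : ℕ)) (fun v hv => by simpa [P] using hv)
          fun u _ v _ h => Fin.ext h
      have hQ : Q.card ≤ F * ((D + 1) * (2 * D * R + 1) ^ d) := by
        have hcj : ∀ v ∈ Q, c v = j := by
          intro v hv
          simp only [Q, Finset.mem_filter, Finset.mem_univ, true_and] at hv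
          have := hpH v
          refine (Nat.div_eq_of_lt_le ?_ ?_).symm
          · exact (Nat.le_add_right _ _).trans hv.2.2.1
          · rw [add_mul, one_mul]; omega
        have h := hg.card_le Q
          (Fin.cons ((i : ℤ) - j * H - D - B) fun e => φ e.succ j - D * R)
          (Fin.cons (D + 1) fun _ => 2 * D * R + 1) ?_
        · simpa [Fin.prod_univ_succ] using h
        · intro v hv e
          have hj := hcj v hv
          simp only [Q, Finset.mem_filter, Finset.mem_univ, true_and] at hv
          rw [hj] at hv
          refine Fin.cases ?_ (fun e => ?_) e
          · have h1 := hp v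
            have h2 : ((j * H + p v : ℕ) : ℤ) ≤ i := by exact_mod_cast hv.2.2.1
            have h3 : (i : ℤ) ≤ (j * H + p v + D : ℕ) := by exact_mod_cast hv.2.2.2
            push_cast at h2 h3
            simp only [Fin.cons_zero]
            push_cast
            constructor <;> linarith
          · have h1 := abs_le.1 (hc.near v (hmem v hv.1 hv.2.1) D (φ e.succ) (hlip _))
            rw [hφ, hj] at h1
            simp only [Fin.cons_succ]
            push_cast
            constructor <;> linarith [h1.1, h1.2]
      exact (Finset.card_le_card hsub).trans ((Finset.card_union_le _ _).trans (by omega))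
    rw [Finset.card_map] at hcard
    omega

end IsGridLabelling

/-! ## Intersection graphs of fat objects have grid labellings -/

theorem IsFatIntersectionGraph.exists_isGridLabelling {d : ℕ} (hd : 1 ≤ d) {β : ℝ} {n : ℕ}
    {G : SimpleGraph (Fin n)} [DecidableRel G.Adj] (hG : IsFatIntersectionGraph d β G) {Δ : ℕ}
    (hΔ : G.maxDegree ≤ Δ) :
    ∃ g : Fin n → Fin d → ℤ, IsGridLabelling G (⌈d * (4 * β)⌉₊ + 1) (Δ + 1) g := by
  classical
  obtain ⟨O, hO, hadj⟩ := hG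
  choose x y hx hy using hO
  have hd0 : (0 : ℝ) < d := by exact_mod_cast hd
  refine ⟨fun v i => ⌊d * x v i⌋, ?_, ?_⟩
  · intro u v huv i
    obtain ⟨-, p, hpu, hpv⟩ := (hadj u v).1 huv
    have hdist : ∀ w, p ∈ O w → dist (x w) p ≤ 2 * β := by
      intro w hp
      have h1 := Metric.mem_closedBall.1 (hy w hp)
      have h2 := Metric.mem_closedBall.1 (hy w (hx w (Metric.mem_ball_self one_pos)))
      have h3 := dist_triangle_right (x w) p (y w)
      linarith
    have h1 : dist (x u) (x v) ≤ 4 * β := by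
      have := dist_triangle_right (x u) (x v) p
      linarith [hdist u hpu, hdist v hpv]
    have h2 : |x u i - x v i| ≤ 4 * β := by
      have := PiLp.norm_apply_le (x u - x v) i
      rw [← dist_eq_norm] at this
      simpa using this.trans h1
    have h3 : |d * x u i - d * x v i| ≤ d * (4 * β) := by
      rw [← mul_sub, abs_mul, abs_of_pos hd0]
      gcongr
    have h4 := Nat.le_ceil ((d : ℝ) * (4 * β))
    rw [abs_le] at h3 ⊢
    have f1 := Int.floor_le ((d : ℝ) * x u i)
    have f2 := Int.lt_floor_add_one ((d : ℝ) * x u i)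
    have f3 := Int.floor_le ((d : ℝ) * x v i)
    have f4 := Int.lt_floor_add_one ((d : ℝ) * x v i)
    push_cast
    constructor
    · have : (-((⌈(d : ℝ) * (4 * β)⌉₊ : ℤ) + 1) : ℝ) ≤
          (⌊(d : ℝ) * x u i⌋ - ⌊(d : ℝ) * x v i⌋ : ℝ) := by
        push_cast; linarith [h3.1]
      exact_mod_cast this
    · have : (⌊(d : ℝ) * x u i⌋ - ⌊(d : ℝ) * x v i⌋ : ℝ) ≤
          (((⌈(d : ℝ) * (4 * β)⌉₊ : ℤ) + 1) : ℝ) := by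
        push_cast; linarith [h3.2]
      exact_mod_cast this
  · intro z
    rcases Finset.eq_empty_or_nonempty
      (Finset.univ.filter fun v => (fun i => ⌊(d : ℝ) * x v i⌋) = z) with h | ⟨v, hv⟩
    · simp [h]
    simp only [Finset.mem_filter, Finset.mem_univ, true_and] at hv
    have hsub : (Finset.univ.filter fun v => (fun i => ⌊(d : ℝ) * x v i⌋) = z) ⊆
        insert v (G.neighborFinset v) := by
      intro u hu
      simp only [Finset.mem_filter, Finset.mem_univ, true_and] at hu
      rw [Finset.mem_insert, SimpleGraph.mem_neighborFinset]
      by_cases huv : u = v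
      · exact Or.inl huv
      refine Or.inr ((hadj v u).2 ⟨fun h => huv h.symm, ?_⟩)
      have hcoord : ∀ i, |x v i - x u i| ≤ 1 / d := by
        intro i
        have h1 : ⌊(d : ℝ) * x v i⌋ = ⌊(d : ℝ) * x u i⌋ :=
          (congrFun hv i).trans (congrFun hu i).symm
        have h2 := (Int.abs_sub_lt_one_of_floor_eq_floor h1).le
        rw [← mul_sub, abs_mul, abs_of_pos hd0] at h2
        rw [le_div_iff₀ hd0]
        linarith
      have hdist : dist (x v) (x u) ≤ 1 := by
        rw [EuclideanSpace.dist_eq, Real.sqrt_le_one]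
        calc ∑ i, dist (x v i) (x u i) ^ 2 ≤ ∑ _i : Fin d, (1 / (d : ℝ)) ^ 2 := by
              gcongr with i
              rw [Real.dist_eq]
              exact hcoord i
          _ = 1 / d := by simp; field_simp
          _ ≤ 1 := by
              rw [div_le_one hd0]
              exact_mod_cast hd
      refine ⟨midpoint ℝ (x v) (x u), hx v ?_, hx u ?_⟩
      · rw [Metric.mem_ball, dist_midpoint_left]
        norm_num
        linarith
      · rw [Metric.mem_ball, dist_midpoint_right]
        norm_num
        linarith
    refine (Finset.card_le_card hsub).trans ((Finset.card_insert_le _ _).trans ?_)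
    have := G.degree_le_maxDegree v
    rw [SimpleGraph.card_neighborFinset_eq_degree]
    omega

/-! ## The covering program

Variables: `0`: number `n` of vertices, `1`: `k`, `2`: `N`, `3`: number of bits of a vertex,
`4`: a power of two, `5`: `⌊k^(1/d)⌋`, `6`: the growth parameter `M`, `7`: number of rounds,
`8`: number of guessed vertices, `9`: number of coins, `10`: the guessed round, `11`, `12`:
counters. Arrays: `0`: adjacency matrix, `1`: output, `2`: coins, `3`: weights, `4`: status of the
vertices (`0`: unassigned, `1`: clustered, `2`: separating), `5`: current ball, `6`: its layer,
`7`: guessed vertices. -/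

namespace SumExpr

/-- Comparison. -/
def lt (e f : SumExpr) : SumExpr := ite (sub f e) (const 1) (const 0)

/-- The product; the variable `y` must not occur in `e` and `f`. -/
def mul (y : ℕ) (e f : SumExpr) : SumExpr := sum y (ite (lt (var y) e) f (const 0))

theorem eval_lt (N : ℕ) (e f : SumExpr) (s : Memory) :
    (lt e f).eval N s = if e.eval N s < f.eval N s then 1 else 0 := by
  by_cases h : e.eval N s < f.eval N s
  · simp [lt, eval, h, Nat.sub_eq_zero_iff_le]
  · simp [lt, eval, h, not_lt.1 h]

theorem eval_mul {N : ℕ} {y : ℕ} {e f : SumExpr} {s : Memory} {a b : ℕ}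
    (he : ∀ i, e.eval N (s.setVar y i) = a) (hf : ∀ i, f.eval N (s.setVar y i) = b)
    (ha : a ≤ N) : (mul y e f).eval N s = a * b := by
  simp only [mul, eval, eval_lt, he, hf, Memory.setVar_var, if_true, ne_eq, ite_eq_right_iff,
    one_ne_zero, imp_false, not_not]
  rw [← Finset.sum_filter, Finset.sum_const, smul_eq_mul]
  congr 1
  rw [show (Finset.range N).filter (· < a) = Finset.range a by ext i; simp; omega,
    Finset.card_range]

theorem eval_sum_ne_zero (N x : ℕ) (e : SumExpr) (s : Memory) :
    (sum x e).eval N s ≠ 0 ↔ ∃ i < N, e.eval N (s.setVar x i) ≠ 0 := by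
  simp [eval, Finset.sum_eq_zero_iff]

end SumExpr

namespace Covering

open SumExpr SumStmt

/-- The `d`-th power of the successor of variable `20`. -/
def powSucc : ℕ → SumExpr
  | 0 => const 1
  | d + 1 => mul 30 (add (var 20) (const 1)) (powSucc d)

/-- Compute the parameters. -/
def setup (d : ℕ) : SumStmt :=
  .seq (set 4 (const 1))
  (.seq (rep (.seq (set 3 (add (var 3) (ite (lt (var 0) (var 4)) (const 0) (const 1))))
    (set 4 (ite (lt (var 0) (var 4)) (var 4) (add (var 4) (var 4))))))
  (.seq (set 5 (sum 20 (ite (lt (var 20) (var 0))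
    (ite (lt (var 1) (powSucc d)) (const 0) (const 1)) (const 0))))
  (.seq (set 6 (sum 20 (lt (mul 30 (var 20) (var 3)) (var 5))))
  (.seq (set 7 (mul 30 (var 6) (var 3)))
  (.seq (set 8 (sum 20 (lt (mul 30 (var 6) (var 20)) (add (var 1) (add (var 1) (var 1))))))
    (set 9 (add (var 7) (mul 30 (var 8) (var 3)))))))))

/-- Is the vertex `20` in the layer of the current ball? -/
def layerE : SumExpr :=
  ite (get 4 (var 20)) (const 0) (ite (get 5 (var 20)) (const 0)
    (sum 21 (ite (get 5 (var 21)) (get 0 (add (mul 30 (var 21) (var 0)) (var 20))) (const 0))))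

/-- Is the vertex `20` the first heaviest unassigned one? -/
def heaviestE : SumExpr :=
  ite (get 4 (var 20)) (const 0) (ite (sum 21 (ite (get 4 (var 21)) (const 0)
    (ite (lt (get 3 (var 20)) (get 3 (var 21))) (const 1)
      (ite (lt (get 3 (var 21)) (get 3 (var 20))) (const 0) (lt (var 21) (var 20))))))
    (const 0) (const 1))

/-- The weight of the set in the array `a`. -/
def weightE (a : ℕ) : SumExpr := sum 21 (ite (get a (var 21)) (get 3 (var 21)) (const 0))

/-- Grow the current ball by one layer if that is heavy. -/
def growS : SumStmt :=
  .seq (fill 6 20 layerE) (fill 5 20 (ite (lt (weightE 5) (mul 30 (var 6) (weightE 6)))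
    (add (get 5 (var 20)) (get 6 (var 20))) (get 5 (var 20))))

/-- Carve out one cluster. -/
def carveS : SumStmt :=
  .seq (fill 5 20 heaviestE) (.seq (rep growS) (.seq (fill 6 20 layerE)
    (fill 4 20 (ite (get 5 (var 20)) (const 1) (ite (get 6 (var 20)) (const 2)
      (get 4 (var 20)))))))

/-- Cluster the graph. -/
def clusterS : SumStmt :=
  .seq (fill 4 20 (ite (lt (var 20) (var 0)) (const 0) (const 1))) (rep carveS)

/-- Is the vertex `20` separating? -/
def sepE : SumExpr := lt (const 1) (get 4 (var 20))

/-- One round: cluster the graph and, unless the guessed round is reached, adapt the weights. -/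
def roundS : SumStmt :=
  .seq clusterS (.seq (fill 3 20 (ite (lt (var 11) (var 10))
    (ite sepE (add (get 3 (var 20)) (get 3 (var 20))) (get 3 (var 20))) (get 3 (var 20))))
    (set 11 (add (var 11) (const 1))))

/-- Read one more bit of every guessed vertex. -/
def decodeS : SumStmt :=
  .seq (fill 7 20 (ite (lt (var 12) (var 3)) (add (add (get 7 (var 20)) (get 7 (var 20)))
    (get 2 (add (var 7) (add (mul 30 (var 20) (var 3)) (var 12))))) (get 7 (var 20))))
    (set 12 (add (var 12) (const 1)))

/-- Is the vertex `20` guessed? -/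
def guessedE : SumExpr :=
  sum 21 (ite (lt (var 21) (var 8)) (ite (lt (get 7 (var 21)) (var 20)) (const 0)
    (ite (lt (var 20) (get 7 (var 21))) (const 0) (const 1))) (const 0))

/-- Compute the output from the coins. -/
def coverS : SumStmt :=
  .seq (set 10 (sum 20 (ite (lt (var 20) (var 7)) (get 2 (var 20)) (const 0))))
  (.seq (fill 3 20 (const 1)) (.seq (rep roundS) (.seq (rep decodeS)
    (fill 1 20 (ite sepE guessedE (const 1))))))

theorem powSucc_wf (d : ℕ) : (powSucc d).WF := by
  induction d with
  | zero => trivial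
  | succ d ih => simp [powSucc, mul, lt, SumExpr.WF, ih]

theorem setup_wf (d : ℕ) : (setup d).WF := by
  simp [setup, SumStmt.WF, SumExpr.WF, mul, lt, powSucc_wf]

theorem coverS_wf : coverS.WF := by
  simp [coverS, roundS, clusterS, carveS, growS, decodeS, layerE, heaviestE, weightE, sepE,
    guessedE, SumStmt.WF, SumExpr.WF, mul, lt]

theorem eval_powSucc {N : ℕ} (d : ℕ) {s : Memory} (h : s.var 20 + 1 ≤ N) :
    (powSucc d).eval N s = (s.var 20 + 1) ^ d := by
  induction d generalizing s with
  | zero => simp [powSucc, SumExpr.eval]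
  | succ d ih =>
    rw [powSucc, eval_mul (a := s.var 20 + 1) (b := (s.var 20 + 1) ^ d) _ _ h, pow_succ, mul_comm]
    · intro i; simp [SumExpr.eval]
    · intro i; rw [ih] <;> simp [h]

/-! ### The parameters -/

/-- The number of `i < n` with `(i + 1) ^ d ≤ k`. -/
def root (d n k : ℕ) : ℕ := ({i ∈ Finset.range n | (i + 1) ^ d ≤ k}).card

/-- The quotient of `q` by `l`, rounded up. -/
def growth (N q l : ℕ) : ℕ := ({i ∈ Finset.range N | i * l < q}).card

/-- The number of guessed vertices. -/
def guesses (N M k : ℕ) : ℕ := ({j ∈ Finset.range N | M * j < 3 * k}).card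

theorem growth_le (N q l : ℕ) : growth N q l ≤ N :=
  (Finset.card_filter_le _ _).trans (Finset.card_range N).le

theorem guesses_le (N M k : ℕ) : guesses N M k ≤ N :=
  (Finset.card_filter_le _ _).trans (Finset.card_range N).le

theorem setup_spec {d n k N : ℕ} (hn : 1 ≤ n) (hN : n + 1 ≤ N) {s : Memory} (h0 : s.var 0 = n)
    (h1 : s.var 1 = k) (h3 : s.var 3 = 0) :
    ∃ l, n < 2 ^ l ∧ 2 ^ l ≤ 2 * n ∧ ((setup d).eval N s).var 3 = l ∧
      ((setup d).eval N s).var 6 = growth N (root d n k) l ∧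
      ((setup d).eval N s).var 7 = growth N (root d n k) l * l ∧
      ((setup d).eval N s).var 8 = guesses N (growth N (root d n k) l) k ∧
      ((setup d).eval N s).var 9 = growth N (root d n k) l * l +
        guesses N (growth N (root d n k) l) k * l := by
  let body : SumStmt := .seq (set 3 (add (var 3) (ite (lt (var 0) (var 4)) (const 0) (const 1))))
    (set 4 (ite (lt (var 0) (var 4)) (var 4) (add (var 4) (var 4))))
  let s₀ := (set 4 (const 1)).eval N s
  have hbody : ∀ j, ((body.eval N)^[j] s₀).var 0 = n ∧ ((body.eval N)^[j] s₀).var 1 = k ∧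
      ((body.eval N)^[j] s₀).var 4 = 2 ^ ((body.eval N)^[j] s₀).var 3 ∧
      ((body.eval N)^[j] s₀).var 4 ≤ 2 * n ∧
      (((body.eval N)^[j] s₀).var 4 ≤ n → ((body.eval N)^[j] s₀).var 3 = j) := by
    intro j
    induction j with
    | zero => simp [s₀, SumStmt.eval, SumExpr.eval, h0, h1, h3]; omega
    | succ j ih =>
      rw [Function.iterate_succ_apply']
      set s₁ := (body.eval N)^[j] s₀
      obtain ⟨i0, i1, i2, i3, i4⟩ := ih
      by_cases hlt : n < s₁.var 4
      · simp [body, SumStmt.eval, SumExpr.eval, eval_lt, i0, i1, hlt]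
        exact ⟨i2, i3⟩
      · simp [body, SumStmt.eval, SumExpr.eval, eval_lt, i0, i1, hlt]
        refine ⟨by rw [i2]; ring, by omega, fun h => i4 (by omega)⟩
  obtain ⟨i0, i1, i2, i3, i4⟩ := hbody N
  have hs : (setup d).eval N s = ((.seq (set 5 (sum 20 (ite (lt (var 20) (var 0))
    (ite (lt (var 1) (powSucc d)) (const 0) (const 1)) (const 0))))
  (.seq (set 6 (sum 20 (lt (mul 30 (var 20) (var 3)) (var 5))))
  (.seq (set 7 (mul 30 (var 6) (var 3)))
  (.seq (set 8 (sum 20 (lt (mul 30 (var 6) (var 20)) (add (var 1) (add (var 1) (var 1))))))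
    (set 9 (add (var 7) (mul 30 (var 8) (var 3)))))))) : SumStmt).eval N ((body.eval N)^[N] s₀) :=
    rfl
  rw [hs]
  clear hs
  generalize (body.eval N)^[N] s₀ = s₁ at i0 i1 i2 i3 i4 ⊢
  set l := s₁.var 3 with hl
  refine ⟨l, ?_, by omega, ?_⟩
  · by_contra hcon
    have h5 := i4 (by omega)
    have h6 : N < 2 ^ N := Nat.lt_two_pow_self
    rw [h5] at hcon
    omega
  have e5 : (sum 20 (ite (lt (var 20) (var 0))
      (ite (lt (var 1) (powSucc d)) (const 0) (const 1)) (const 0))).eval N s₁ = root d n k := by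
    rw [root, Finset.card_filter]
    simp only [SumExpr.eval, eval_lt]
    rw [← Finset.sum_subset (Finset.range_subset_range.2 (by omega : n ≤ N))]
    · refine Finset.sum_congr rfl fun i hi => ?_
      have hi := Finset.mem_range.1 hi
      rw [eval_powSucc d (by simp; omega)]
      simp [i0, i1, hi]
      split_ifs <;> omega
    · intro i _ hi
      simp at hi
      simp [i0, hi]
  have e6 : ∀ s₂ : Memory, s₂.var 3 = l → (sum 20 (lt (mul 30 (var 20) (var 3)) (var 5))).eval N s₂
      = growth N (s₂.var 5) l := by
    intro s₂ h₂
    rw [growth, Finset.card_filter]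
    refine Finset.sum_congr rfl fun i hi => ?_
    have hi := Finset.mem_range.1 hi
    rw [eval_lt, eval_mul (a := i) (b := l) (fun j => by simp [SumExpr.eval])
      (fun j => by simp [SumExpr.eval, h₂]) hi.le]
    simp [SumExpr.eval]
  have hM := growth_le N (root d n k) l
  have e7 : ∀ s₂ : Memory, s₂.var 3 = l → s₂.var 6 ≤ N →
      (mul 30 (var 6) (var 3)).eval N s₂ = s₂.var 6 * l := by
    intro s₂ h₂ h₃
    exact eval_mul (fun j => by simp [SumExpr.eval]) (fun j => by simp [SumExpr.eval, h₂]) h₃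
  have e8 : ∀ s₂ : Memory, s₂.var 1 = k → s₂.var 6 ≤ N →
      (sum 20 (lt (mul 30 (var 6) (var 20)) (add (var 1) (add (var 1) (var 1))))).eval N s₂ =
        guesses N (s₂.var 6) k := by
    intro s₂ h₂ h₃
    rw [guesses, Finset.card_filter]
    refine Finset.sum_congr rfl fun i hi => ?_
    rw [eval_lt, eval_mul (a := s₂.var 6) (b := i) (fun j => by simp [SumExpr.eval])
      (fun j => by simp [SumExpr.eval]) h₃]
    simp [SumExpr.eval, h₂, show k + (k + k) = 3 * k by ring]
  have e9 : ∀ s₂ : Memory, s₂.var 3 = l → s₂.var 8 ≤ N →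
      (mul 30 (var 8) (var 3)).eval N s₂ = s₂.var 8 * l := by
    intro s₂ h₂ h₃
    exact eval_mul (fun j => by simp [SumExpr.eval]) (fun j => by simp [SumExpr.eval, h₂]) h₃
  simp only [SumStmt.eval]
  rw [e5]
  set s₂ := s₁.setVar 5 (root d n k) with hs₂
  rw [e6 s₂ (by simp [s₂, ← hl]), show s₂.var 5 = root d n k by simp [s₂]]
  set s₃ := s₂.setVar 6 (growth N (root d n k) l) with hs₃
  have h36 : s₃.var 6 = growth N (root d n k) l := by simp [s₃]
  rw [e7 s₃ (by simp [s₃, s₂, ← hl]) (by rw [h36]; exact hM), h36]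
  set s₄ := s₃.setVar 7 (growth N (root d n k) l * l) with hs₄
  have h46 : s₄.var 6 = growth N (root d n k) l := by simp [s₄, h36]
  rw [e8 s₄ (by simp [s₄, s₃, s₂, i1]) (by rw [h46]; exact hM), h46]
  set s₅ := s₄.setVar 8 (guesses N (growth N (root d n k) l) k) with hs₅
  have h58 : s₅.var 8 = guesses N (growth N (root d n k) l) k := by simp [s₅]
  have e9' := e9 s₅ (by simp [s₅, s₄, s₃, s₂, ← hl]) (by rw [h58]; exact guesses_le _ _ _)
  simp [SumExpr.eval, e9', s₅, s₄, s₃, s₂, ← hl]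

end Covering

namespace Covering

open SumExpr SumStmt

/-! ### The clustering -/

/-- The memory holds a graph, weights and a partial clustering. -/
structure Rep (adj : ℕ → ℕ → Prop) (n M N : ℕ) (w : ℕ → ℕ) (S : Finset ℕ × Finset ℕ)
    (s : Memory) : Prop where
  n_eq : s.var 0 = n
  M_eq : s.var 6 = M
  adj_iff : ∀ y < n, ∀ x < n, s.arr 0 (y * n + x) ≠ 0 ↔ adj y x
  weight : ∀ x < N, s.arr 3 x = w x
  status : ∀ x < N, s.arr 4 x = if x ∈ S.1 then 0 else if x ∈ S.2 then 2 else 1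
  subset : S.1 ⊆ Finset.range n
  disjoint : Disjoint S.1 S.2

/-- The array `a` holds the set `B`. -/
def RepSet (N a : ℕ) (B : Finset ℕ) (s : Memory) : Prop := ∀ x < N, s.arr a x ≠ 0 ↔ x ∈ B

variable {adj : ℕ → ℕ → Prop} {n M N : ℕ} {w : ℕ → ℕ} {S : Finset ℕ × Finset ℕ} {s : Memory}
  {B : Finset ℕ}

theorem Rep.status_eq_zero (h : Rep adj n M N w S s) {x : ℕ} (hx : x < N) :
    s.arr 4 x = 0 ↔ x ∈ S.1 := by
  rw [h.status x hx]
  split_ifs <;> simp_all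

theorem Rep.congr (h : Rep adj n M N w S s) {s' : Memory} (h0 : s'.var 0 = s.var 0)
    (h6 : s'.var 6 = s.var 6) (ha : s'.arr 0 = s.arr 0) (h3 : s'.arr 3 = s.arr 3)
    (h4 : s'.arr 4 = s.arr 4) : Rep adj n M N w S s' :=
  ⟨h0.trans h.n_eq, h6.trans h.M_eq, ha ▸ h.adj_iff, h3 ▸ h.weight, h4 ▸ h.status, h.subset,
    h.disjoint⟩

theorem eval_layerE (hn : n ≤ N) (h : Rep adj n M N w S s) (hB : RepSet N 5 B s) (hBS : B ⊆ S.1)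
    {x : ℕ} (hx : x < N) : layerE.eval N (s.setVar 20 x) ≠ 0 ↔ x ∈ layer adj S.1 B := by
  classical
  have hlt : ∀ y ∈ S.1, y < n := fun y hy => Finset.mem_range.1 (h.subset hy)
  have h4 := h.status_eq_zero hx
  have h5 := hB x hx
  have hterm : ∀ y < N, ((ite (get 5 (var 21)) (get 0 (add (mul 30 (var 21) (var 0)) (var 20)))
      (const 0)).eval N ((s.setVar 20 x).setVar 21 y) ≠ 0 ↔
        y ∈ B ∧ s.arr 0 (y * n + x) ≠ 0) := by
    intro y hy
    have h5y := hB y hy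
    simp only [SumExpr.eval]
    rw [eval_mul (a := y) (b := n) (fun i => by simp [SumExpr.eval])
      (fun i => by simp [SumExpr.eval, h.n_eq]) hy.le]
    by_cases hy5 : s.arr 5 y = 0
    · simp [hy5, ← h5y]
    · simp [hy5, ← h5y]
  simp only [layer, Finset.mem_filter]
  by_cases hxS : x ∈ S.1
  · by_cases hxB : x ∈ B
    · have : s.arr 5 x ≠ 0 := h5.2 hxB
      simp [layerE, SumExpr.eval, this, hxB]
    · have h5' : s.arr 5 x = 0 := by by_contra h'; exact hxB (h5.1 h')
      have : layerE.eval N (s.setVar 20 x) = (sum 21 (ite (get 5 (var 21))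
          (get 0 (add (mul 30 (var 21) (var 0)) (var 20))) (const 0))).eval N (s.setVar 20 x) := by
        simp [layerE, SumExpr.eval, h4.2 hxS, h5']
      rw [this, eval_sum_ne_zero]
      constructor
      · rintro ⟨y, hy, hne⟩
        obtain ⟨hyB, hadj⟩ := (hterm y hy).1 hne
        exact ⟨hxS, hxB, y, hyB, (h.adj_iff y (hlt y (hBS hyB)) x (hlt x hxS)).1 hadj⟩
      · rintro ⟨-, -, y, hyB, hadj⟩
        have hyn := hlt y (hBS hyB)
        exact ⟨y, by omega, (hterm y (by omega)).2
          ⟨hyB, (h.adj_iff y hyn x (hlt x hxS)).2 hadj⟩⟩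
  · have : s.arr 4 x ≠ 0 := fun h' => hxS (h4.1 h')
    simp [layerE, SumExpr.eval, this, hxS]

theorem eval_heaviestE (hn : n ≤ N) (h : Rep adj n M N w S s) {x : ℕ} (hx : x < N) :
    heaviestE.eval N (s.setVar 20 x) ≠ 0 ↔ x ∈ heaviest w S.1 := by
  classical
  have hlt : ∀ y ∈ S.1, y < n := fun y hy => Finset.mem_range.1 (h.subset hy)
  have h4 := h.status_eq_zero hx
  have hterm : ∀ y < N, ((ite (get 4 (var 21)) (const 0)
      (ite (lt (get 3 (var 20)) (get 3 (var 21))) (const 1)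
      (ite (lt (get 3 (var 21)) (get 3 (var 20))) (const 0) (lt (var 21) (var 20))))).eval N
        ((s.setVar 20 x).setVar 21 y) ≠ 0 ↔
          y ∈ S.1 ∧ ¬ (w y < w x ∨ (w y = w x ∧ x ≤ y))) := by
    intro y hy
    rw [← h.status_eq_zero hy]
    by_cases hy4 : s.arr 4 y = 0
    · simp [SumExpr.eval, eval_lt, hy4, h.weight x hx, h.weight y hy]
      split_ifs <;> simp <;> omega
    · simp [SumExpr.eval, hy4]
  simp only [heaviest, Finset.mem_filter]
  by_cases hxS : x ∈ S.1
  · have hval : heaviestE.eval N (s.setVar 20 x) ≠ 0 ↔ ¬ (sum 21 (ite (get 4 (var 21)) (const 0)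
        (ite (lt (get 3 (var 20)) (get 3 (var 21))) (const 1)
        (ite (lt (get 3 (var 21)) (get 3 (var 20))) (const 0) (lt (var 21) (var 20)))))).eval N
          (s.setVar 20 x) ≠ 0 := by
      rw [heaviestE]
      simp only [SumExpr.eval, Memory.setVar_var, Memory.setVar_arr, if_true, h4.2 hxS, ne_eq,
        not_true_eq_false, if_false]
      split_ifs <;> simp_all
    rw [hval, eval_sum_ne_zero]
    constructor
    · intro hno
      refine ⟨hxS, fun u hu => ?_⟩
      by_contra hcon
      have hun := hlt u hu
      exact hno ⟨u, by omega, (hterm u (by omega)).2 ⟨hu, hcon⟩⟩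
    · rintro ⟨-, hall⟩ ⟨u, hu, hne⟩
      obtain ⟨huS, hcon⟩ := (hterm u hu).1 hne
      exact hcon (hall u huS)
  · have : s.arr 4 x ≠ 0 := fun h' => hxS (h4.1 h')
    simp [heaviestE, SumExpr.eval, this, hxS]

theorem eval_weightE {a : ℕ} (hB : RepSet N a B s) (hBN : B ⊆ Finset.range N)
    (hw : ∀ x < N, s.arr 3 x = w x) : (weightE a).eval N s = ∑ x ∈ B, w x := by
  rw [← Finset.inter_eq_right.2 hBN, ← Finset.filter_mem_eq_inter, Finset.sum_filter]
  refine Finset.sum_congr rfl fun x hx => ?_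
  have hx := Finset.mem_range.1 hx
  have := hB x hx
  by_cases hxB : x ∈ B
  · simp [SumExpr.eval, this.2 hxB, hxB, hw x hx]
  · have h0 : s.arr a x = 0 := by by_contra h'; exact hxB (this.1 h')
    simp [SumExpr.eval, h0, hxB]

theorem fill_arr_self (a x : ℕ) (e : SumExpr) (s : Memory) {i : ℕ} (hi : i < N) :
    ((fill a x e).eval N s).arr a i = e.eval N (s.setVar x i) := by
  simp [SumStmt.eval, hi]

theorem fill_arr_of_ne {a b : ℕ} (hab : b ≠ a) (x : ℕ) (e : SumExpr) (s : Memory) :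
    ((fill a x e).eval N s).arr b = s.arr b := by
  simp [SumStmt.eval, hab]

theorem growS_spec (hn : n ≤ N) (hM : M ≤ N) (h : Rep adj n M N w S s) (hB : RepSet N 5 B s)
    (hBS : B ⊆ S.1) : RepSet N 5 (grow adj M w S.1 B) (growS.eval N s) := by
  intro x hx
  have hSN : S.1 ⊆ Finset.range N := h.subset.trans (Finset.range_subset_range.2 hn)
  set s₁ := (fill 6 20 layerE).eval N s with hs₁
  have h₁ : Rep adj n M N w S s₁ := h.congr rfl rfl (fill_arr_of_ne (by decide) _ _ _)
    (fill_arr_of_ne (by decide) _ _ _) (fill_arr_of_ne (by decide) _ _ _)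
  have hB₁ : RepSet N 5 B s₁ := by
    intro y hy
    rw [hs₁, fill_arr_of_ne (by decide)]
    exact hB y hy
  have hL₁ : RepSet N 6 (layer adj S.1 B) s₁ := by
    intro y hy
    rw [hs₁, fill_arr_self _ _ _ _ hy]
    exact eval_layerE hn h hB hBS hy
  have hev : growS.eval N s = (fill 5 20 (ite (lt (weightE 5) (mul 30 (var 6) (weightE 6)))
    (add (get 5 (var 20)) (get 6 (var 20))) (get 5 (var 20)))).eval N s₁ := rfl
  rw [hev, fill_arr_self _ _ _ _ hx]
  have e5 : (weightE 5).eval N (s₁.setVar 20 x) = ∑ y ∈ B, w y :=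
    eval_weightE hB₁ (hBS.trans hSN) h₁.weight
  have e6 : ∀ i, (weightE 6).eval N ((s₁.setVar 20 x).setVar 30 i) =
      ∑ y ∈ layer adj S.1 B, w y := fun i =>
    eval_weightE hL₁ ((layer_subset _ _ _).trans hSN) h₁.weight
  have em : (mul 30 (var 6) (weightE 6)).eval N (s₁.setVar 20 x) =
      M * ∑ y ∈ layer adj S.1 B, w y :=
    eval_mul (fun i => by simp [SumExpr.eval, h₁.M_eq]) e6 hM
  have h5 := hB₁ x hx
  have h6 := hL₁ x hx
  simp only [SumExpr.eval, eval_lt, e5, em, grow]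
  by_cases hlt : ∑ y ∈ B, w y < M * ∑ y ∈ layer adj S.1 B, w y
  · simp only [hlt, if_true, Memory.setVar_var, Memory.setVar_arr, ne_eq, one_ne_zero,
      not_false_eq_true, Finset.mem_union, ← h5, ← h6]
    omega
  · simp only [hlt, if_false, Memory.setVar_var, Memory.setVar_arr, ne_eq, if_true,
      not_true_eq_false, ← h5]

theorem growS_rep (h : Rep adj n M N w S s) : Rep adj n M N w S (growS.eval N s) :=
  h.congr (eval_var N (by decide) s) (eval_var N (by decide) s) (eval_arr N (by decide) s)
    (eval_arr N (by decide) s) (eval_arr N (by decide) s)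

theorem growS_iterate_spec (hn : n ≤ N) (hM : M ≤ N) (h : Rep adj n M N w S s)
    (hB : RepSet N 5 (heaviest w S.1) s) (r : ℕ) :
    Rep adj n M N w S ((growS.eval N)^[r] s) ∧
      RepSet N 5 ((grow adj M w S.1)^[r] (heaviest w S.1)) ((growS.eval N)^[r] s) := by
  induction r with
  | zero => exact ⟨h, hB⟩
  | succ r ih =>
    simp only [Function.iterate_succ_apply']
    exact ⟨growS_rep ih.1, growS_spec hn hM ih.1 ih.2 (grow_iterate_subset _ _ _ _ _)⟩

theorem carveS_spec (hn : n ≤ N) (hM : M ≤ N) (h : Rep adj n M N w S s) :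
    Rep adj n M N w (carve adj M w N S) (carveS.eval N s) := by
  set s₁ := (fill 5 20 heaviestE).eval N s with hs₁
  have h₁ : Rep adj n M N w S s₁ := h.congr rfl rfl (fill_arr_of_ne (by decide) _ _ _)
    (fill_arr_of_ne (by decide) _ _ _) (fill_arr_of_ne (by decide) _ _ _)
  have hB₁ : RepSet N 5 (heaviest w S.1) s₁ := by
    intro y hy
    rw [hs₁, fill_arr_self _ _ _ _ hy]
    exact eval_heaviestE hn h hy
  obtain ⟨h₂, hB₂⟩ := growS_iterate_spec hn hM h₁ hB₁ N
  change RepSet N 5 (grownBall adj M w N S.1) _ at hB₂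
  set s₂ := (growS.eval N)^[N] s₁
  have hBS : grownBall adj M w N S.1 ⊆ S.1 := grow_iterate_subset _ _ _ _ _
  set s₃ := (fill 6 20 layerE).eval N s₂ with hs₃
  have h₃ : Rep adj n M N w S s₃ := h₂.congr rfl rfl (fill_arr_of_ne (by decide) _ _ _)
    (fill_arr_of_ne (by decide) _ _ _) (fill_arr_of_ne (by decide) _ _ _)
  have hB₃ : RepSet N 5 (grownBall adj M w N S.1) s₃ := by
    intro y hy
    rw [hs₃, fill_arr_of_ne (by decide)]
    exact hB₂ y hy
  have hL₃ : RepSet N 6 (layer adj S.1 (grownBall adj M w N S.1)) s₃ := by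
    intro y hy
    rw [hs₃, fill_arr_self _ _ _ _ hy]
    exact eval_layerE hn h₂ hB₂ hBS hy
  have hev : carveS.eval N s = (fill 4 20 (ite (get 5 (var 20)) (const 1)
    (ite (get 6 (var 20)) (const 2) (get 4 (var 20))))).eval N s₃ := rfl
  rw [hev]
  refine ⟨h₃.n_eq, h₃.M_eq, ?_, ?_, fun x hx => ?_, ?_, ?_⟩
  · rw [fill_arr_of_ne (by decide)]; exact h₃.adj_iff
  · rw [fill_arr_of_ne (by decide)]; exact h₃.weight
  · rw [fill_arr_self _ _ _ _ hx]
    have h5 := hB₃ x hx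
    have h6 := hL₃ x hx
    have h4 := h₃.status x hx
    have hdis : x ∈ grownBall adj M w N S.1 → x ∉ layer adj S.1 (grownBall adj M w N S.1) :=
      fun hx => Finset.disjoint_left.1 (disjoint_layer _ _ _) hx
    have hLS : x ∈ layer adj S.1 (grownBall adj M w N S.1) → x ∈ S.1 :=
      fun hx => layer_subset _ _ _ hx
    have hBS' : x ∈ grownBall adj M w N S.1 → x ∈ S.1 := fun hx => hBS hx
    have hSE : x ∈ S.1 → x ∉ S.2 := fun hx => Finset.disjoint_left.1 h.disjoint hx
    simp only [SumExpr.eval, Memory.setVar_var, Memory.setVar_arr, if_true, h5, h6, h4, carve,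
      Finset.mem_sdiff, Finset.mem_union]
    by_cases hxB : x ∈ grownBall adj M w N S.1
    · simp [hxB, hdis hxB, hSE (hBS' hxB)]
    · by_cases hxL : x ∈ layer adj S.1 (grownBall adj M w N S.1)
      · simp [hxB, hxL]
      · simp [hxB, hxL]
  · exact Finset.sdiff_subset.trans h.subset
  · refine Finset.disjoint_left.2 fun x hx hx' => ?_
    simp only [carve, Finset.mem_sdiff, Finset.mem_union, not_or] at hx hx'
    rcases hx' with hx' | hx'
    · exact Finset.disjoint_left.1 h.disjoint hx.1 hx'
    · exact hx.2.2 hx'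

theorem clusterS_spec (hn : n ≤ N) (hM : M ≤ N) (h0 : s.var 0 = n) (h6 : s.var 6 = M)
    (hadj : ∀ y < n, ∀ x < n, s.arr 0 (y * n + x) ≠ 0 ↔ adj y x)
    (hw : ∀ x < N, s.arr 3 x = w x) :
    Rep adj n M N w ((carve adj M w N)^[N] (Finset.range n, ∅)) (clusterS.eval N s) := by
  set s₁ := (fill 4 20 (ite (lt (var 20) (var 0)) (const 0) (const 1))).eval N s with hs₁
  have h₁ : Rep adj n M N w (Finset.range n, ∅) s₁ := by
    refine ⟨h0, h6, ?_, ?_, fun x hx => ?_, subset_rfl, Finset.disjoint_empty_right _⟩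
    · rw [hs₁, fill_arr_of_ne (by decide)]; exact hadj
    · rw [hs₁, fill_arr_of_ne (by decide)]; exact hw
    · rw [hs₁, fill_arr_self _ _ _ _ hx]
      simp [SumExpr.eval, eval_lt, h0]
  have key : ∀ j, Rep adj n M N w ((carve adj M w N)^[j] (Finset.range n, ∅))
      ((carveS.eval N)^[j] s₁) := by
    intro j
    induction j with
    | zero => exact h₁
    | succ j ih =>
      simp only [Function.iterate_succ_apply']
      exact carveS_spec hn hM ih
  exact key N

end Covering

namespace Covering

open SumExpr SumStmt

variable {adj : ℕ → ℕ → Prop} {n M N J : ℕ} {w : ℕ → ℕ} {s : Memory}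

/-! ### The rounds -/

/-- The state of the memory before a round. -/
structure RoundRep (adj : ℕ → ℕ → Prop) (n M N J : ℕ) (w : ℕ → ℕ) (s : Memory) : Prop where
  n_eq : s.var 0 = n
  M_eq : s.var 6 = M
  J_eq : s.var 10 = J
  adj_iff : ∀ y < n, ∀ x < n, s.arr 0 (y * n + x) ≠ 0 ↔ adj y x
  weight : ∀ x < N, s.arr 3 x = w x

theorem eval_sepE {S : Finset ℕ × Finset ℕ} (h : Rep adj n M N w S s) {x : ℕ} (hx : x < N) :
    sepE.eval N (s.setVar 20 x) ≠ 0 ↔ x ∈ S.2 := by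
  have h4 := h.status x hx
  have hdis : x ∈ S.1 → x ∉ S.2 := fun hx => Finset.disjoint_left.1 h.disjoint hx
  simp only [sepE, eval_lt, SumExpr.eval, Memory.setVar_var, Memory.setVar_arr, if_true, h4]
  by_cases h1 : x ∈ S.1
  · simp [h1, hdis h1]
  · by_cases h2 : x ∈ S.2 <;> simp [h1, h2]

theorem roundS_spec (hn : n ≤ N) (hM : M ≤ N) (h : RoundRep adj n M N J w s) :
    RoundRep adj n M N J (if s.var 11 < J then reweight adj M N n w else w) (roundS.eval N s) ∧
      (roundS.eval N s).var 11 = s.var 11 + 1 ∧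
      ∀ x < N, sepE.eval N ((roundS.eval N s).setVar 20 x) ≠ 0 ↔ x ∈ boundary adj M N n w := by
  have h₁ := clusterS_spec hn hM h.n_eq h.M_eq h.adj_iff h.weight
  have h11 : (clusterS.eval N s).var 11 = s.var 11 := eval_var N (by decide) s
  have h10 : (clusterS.eval N s).var 10 = J := (eval_var N (by decide) s).trans h.J_eq
  set s₁ := clusterS.eval N s
  have hev : roundS.eval N s = (set 11 (add (var 11) (const 1))).eval N
    ((fill 3 20 (ite (lt (var 11) (var 10))
    (ite sepE (add (get 3 (var 20)) (get 3 (var 20))) (get 3 (var 20)))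
      (get 3 (var 20)))).eval N s₁) := rfl
  rw [hev]
  refine ⟨⟨?_, ?_, ?_, ?_, fun x hx => ?_⟩, ?_, fun x hx => ?_⟩
  · exact h₁.n_eq
  · exact h₁.M_eq
  · exact h10
  · intro y hy x hx
    rw [← h₁.adj_iff y hy x hx]
    rfl
  · have h3 := h₁.weight x hx
    have hsep := eval_sepE h₁ hx
    have hval : ∀ (t : Memory) (e : SumExpr), ((set 11 e).eval N t).arr = t.arr := fun _ _ => rfl
    rw [hval, fill_arr_self _ _ _ _ hx]
    simp only [SumExpr.eval, eval_lt, hsep, Memory.setVar_var, Memory.setVar_arr, if_true, h3,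
      h11, h10]
    by_cases hJ : s.var 11 < J
    · by_cases hb : x ∈ ((carve adj M w N)^[N] (Finset.range n, ∅)).2 <;>
        simp [hJ, reweight, boundary, hb]
    · simp [hJ]
  · simp only [SumStmt.eval, SumExpr.eval, Memory.setVar_var, if_true, h11]
  · rw [← show _ ↔ x ∈ boundary adj M N n w from eval_sepE h₁ hx]
    rfl

theorem roundS_iterate_spec (hn : n ≤ N) (hM : M ≤ N) (h : RoundRep adj n M N J (fun _ => 1) s)
    (h11 : s.var 11 = 0) (j : ℕ) :
    RoundRep adj n M N J ((reweight adj M N n)^[min j J] fun _ => 1) ((roundS.eval N)^[j] s) ∧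
      ((roundS.eval N)^[j] s).var 11 = j ∧ ∀ x < N, J < j →
        (sepE.eval N (((roundS.eval N)^[j] s).setVar 20 x) ≠ 0 ↔
          x ∈ boundary adj M N n ((reweight adj M N n)^[J] fun _ => 1)) := by
  induction j with
  | zero => exact ⟨by simpa using h, h11, fun x _ hJ => by omega⟩
  | succ j ih =>
    obtain ⟨h1, h2, -⟩ := ih
    obtain ⟨h3, h4, h5⟩ := roundS_spec hn hM h1
    rw [Function.iterate_succ_apply']
    refine ⟨?_, by rw [h4, h2], fun x hx hJ => ?_⟩
    · rw [h2] at h3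
      by_cases hj : j < J
      · rw [if_pos hj, ← Function.iterate_succ_apply' (reweight adj M N n)] at h3
        rwa [show min (j + 1) J = (min j J).succ by omega]
      · rw [if_neg hj] at h3
        rwa [show min (j + 1) J = min j J by omega]
    · rw [h5 x hx, show min j J = J by omega]

/-! ### The guessed vertices -/

/-- The number with the binary digits `f 0, …, f (m - 1)`, the most significant digit first. -/
def ofDigits (f : ℕ → ℕ) : ℕ → ℕ
  | 0 => 0
  | m + 1 => ofDigits f m + ofDigits f m + f m

theorem ofDigits_congr {f f' : ℕ → ℕ} {m : ℕ} (h : ∀ i < m, f i = f' i) :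
    ofDigits f m = ofDigits f' m := by
  induction m with
  | zero => rfl
  | succ m ih => rw [ofDigits, ofDigits, ih fun i hi => h i (by omega), h m (by omega)]

theorem ofDigits_div_mod {v l : ℕ} (hv : v < 2 ^ l) :
    ofDigits (fun i => v / 2 ^ (l - 1 - i) % 2) l = v := by
  have key : ∀ m ≤ l, ofDigits (fun i => v / 2 ^ (l - 1 - i) % 2) m = v / 2 ^ (l - m) := by
    intro m
    induction m with
    | zero => intro _; simp [ofDigits, Nat.div_eq_of_lt hv]
    | succ m ih =>
      intro hm
      rw [ofDigits, ih (by omega), show l - m = l - (m + 1) + 1 by omega,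
        show l - 1 - m = l - (m + 1) by omega, pow_succ, ← Nat.div_div_eq_div_mul]
      omega
  simpa using key l le_rfl

theorem decodeS_iterate_spec {T l : ℕ} (h7 : s.var 7 = T) (h3 : s.var 3 = l) (h12 : s.var 12 = 0)
    (hz : ∀ x < N, s.arr 7 x = 0) (j : ℕ) :
    ((decodeS.eval N)^[j] s).var 12 = j ∧ ∀ x < N, ((decodeS.eval N)^[j] s).arr 7 x =
      ofDigits (fun m => s.arr 2 (T + (x * l + m))) (min j l) := by
  induction j with
  | zero => exact ⟨h12, fun x hx => by simpa [ofDigits] using hz x hx⟩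
  | succ j ih =>
    obtain ⟨i1, i2⟩ := ih
    have hfix : ∀ j, ((decodeS.eval N)^[j] s).var 7 = T ∧ ((decodeS.eval N)^[j] s).var 3 = l ∧
        ((decodeS.eval N)^[j] s).arr 2 = s.arr 2 := by
      intro j
      induction j with
      | zero => exact ⟨h7, h3, rfl⟩
      | succ j ih =>
        simp only [Function.iterate_succ_apply']
        rw [eval_var N (by decide), eval_var N (by decide), eval_arr N (by decide)]
        exact ih
    obtain ⟨f7, f3, f2⟩ := hfix j
    rw [Function.iterate_succ_apply']
    set s₁ := (decodeS.eval N)^[j] s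
    have hev : decodeS.eval N s₁ = (set 12 (add (var 12) (const 1))).eval N
      ((fill 7 20 (ite (lt (var 12) (var 3)) (add (add (get 7 (var 20)) (get 7 (var 20)))
      (get 2 (add (var 7) (add (mul 30 (var 20) (var 3)) (var 12))))) (get 7 (var 20)))).eval N s₁)
        := rfl
    rw [hev]
    refine ⟨?_, fun x hx => ?_⟩
    · simp [SumStmt.eval, SumExpr.eval, i1]
    · have hval : ∀ (t : Memory) (e : SumExpr), ((set 12 e).eval N t).arr = t.arr := fun _ _ => rfl
      rw [hval, fill_arr_self _ _ _ _ hx]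
      have em : (mul 30 (var 20) (var 3)).eval N (s₁.setVar 20 x) = x * l :=
        eval_mul (fun i => by simp [SumExpr.eval]) (fun i => by simp [SumExpr.eval, f3]) hx.le
      simp only [SumExpr.eval, eval_lt, em, Memory.setVar_var, Memory.setVar_arr, if_true, i2 x hx]
      simp only [show (12 : ℕ) ≠ 20 by decide, show (3 : ℕ) ≠ 20 by decide,
        show (7 : ℕ) ≠ 20 by decide, if_false, i1, f3, f7, f2]
      by_cases hj : j < l
      · simp [hj, show min j l = j by omega, ofDigits]
      · simp [hj, show min (j + 1) l = l by omega, show min j l = l by omega]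

theorem eval_guessedE {g x : ℕ} (h8 : s.var 8 = g) (hg : g ≤ N) :
    guessedE.eval N (s.setVar 20 x) ≠ 0 ↔ ∃ j < g, s.arr 7 j = x := by
  rw [guessedE, eval_sum_ne_zero]
  have hterm : ∀ j, (ite (lt (var 21) (var 8)) (ite (lt (get 7 (var 21)) (var 20)) (const 0)
      (ite (lt (var 20) (get 7 (var 21))) (const 0) (const 1))) (const 0)).eval N
        ((s.setVar 20 x).setVar 21 j) ≠ 0 ↔ j < g ∧ s.arr 7 j = x := by
    intro j
    simp [SumExpr.eval, eval_lt, h8]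
    omega
  simp only [hterm]
  exact ⟨fun ⟨j, _, h⟩ => ⟨j, h⟩, fun ⟨j, h⟩ => ⟨j, by omega, h⟩⟩

/-! ### The output -/

theorem coverS_spec {l T g : ℕ} (hn : n ≤ N) (hM : M ≤ N) (hT : T < N) (hl : l ≤ N) (hg : g ≤ N)
    (h0 : s.var 0 = n) (h3 : s.var 3 = l) (h6 : s.var 6 = M) (h7 : s.var 7 = T) (h8 : s.var 8 = g)
    (h11 : s.var 11 = 0) (h12 : s.var 12 = 0)
    (hadj : ∀ y < n, ∀ x < n, s.arr 0 (y * n + x) ≠ 0 ↔ adj y x) (hz : ∀ x < N, s.arr 7 x = 0)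
    (hJ : ∑ i ∈ Finset.range T, s.arr 2 i = J) (hJN : J < N) {x : ℕ} (hx : x < N) :
    (coverS.eval N s).arr 1 x ≠ 0 ↔
      x ∉ boundary adj M N n ((reweight adj M N n)^[J] fun _ => 1) ∨
        ∃ j < g, ofDigits (fun m => s.arr 2 (T + (j * l + m))) l = x := by
  set s₁ := (set 10 (sum 20 (ite (lt (var 20) (var 7)) (get 2 (var 20)) (const 0)))).eval N s
    with hs₁
  have hJ₁ : s₁.var 10 = J := by
    simp only [hs₁, SumStmt.eval, Memory.setVar_var, if_true, SumExpr.eval, eval_lt,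
      Memory.setVar_arr]
    rw [← hJ, ← Finset.sum_subset (Finset.range_subset_range.2 hT.le)]
    · refine Finset.sum_congr rfl fun i hi => ?_
      simp [h7, Finset.mem_range.1 hi]
    · intro i _ hi
      simp at hi
      simp [h7, hi]
  have hv₁ : ∀ y, y ≠ 10 → s₁.var y = s.var y := fun y hy => by simp [hs₁, SumStmt.eval, hy]
  set s₂ := (fill 3 20 (const 1)).eval N s₁ with hs₂
  have hR₂ : RoundRep adj n M N J (fun _ => 1) s₂ := by
    refine ⟨?_, ?_, hJ₁, ?_, fun x hx => ?_⟩
    · exact (hv₁ 0 (by decide)).trans h0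
    · exact (hv₁ 6 (by decide)).trans h6
    · rw [hs₂, fill_arr_of_ne (by decide)]; exact hadj
    · rw [hs₂, fill_arr_self _ _ _ _ hx]; rfl
  obtain ⟨-, -, hsep⟩ := roundS_iterate_spec hn hM hR₂ ((hv₁ 11 (by decide)).trans h11) N
  set s₃ := (rep roundS).eval N s₂ with hs₃
  change ∀ x < N, J < N → (sepE.eval N (s₃.setVar 20 x) ≠ 0 ↔ _) at hsep
  have hv₃ : ∀ y, y ≠ 10 → y ≠ 11 → s₃.var y = s.var y := by
    intro y hy hy'
    rw [hs₃, eval_var N (by simp [SumStmt.vars, roundS, clusterS, carveS, growS, hy'])]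
    exact hv₁ y hy
  have ha₃ : ∀ a, a = 2 ∨ a = 7 → s₃.arr a = s.arr a := by
    intro a ha
    rw [hs₃, eval_arr N (by rcases ha with rfl | rfl <;> decide), hs₂,
      fill_arr_of_ne (by rcases ha with rfl | rfl <;> decide)]
    rfl
  obtain ⟨-, hdec⟩ := decodeS_iterate_spec (N := N) (s := s₃)
    ((hv₃ 7 (by decide) (by decide)).trans h7) ((hv₃ 3 (by decide) (by decide)).trans h3)
    ((hv₃ 12 (by decide) (by decide)).trans h12) (by rw [ha₃ 7 (Or.inr rfl)]; exact hz) N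
  rw [ha₃ 2 (Or.inl rfl), min_eq_right hl] at hdec
  set s₄ := (rep decodeS).eval N s₃ with hs₄
  change ∀ x < N, s₄.arr 7 x = _ at hdec
  have hsep₄ : sepE.eval N (s₄.setVar 20 x) = sepE.eval N (s₃.setVar 20 x) := by
    have h4 : s₄.arr 4 = s₃.arr 4 := eval_arr N (by decide) s₃
    simp [sepE, eval_lt, SumExpr.eval, h4]
  have hguess : guessedE.eval N (s₄.setVar 20 x) ≠ 0 ↔ ∃ j < g, s₄.arr 7 j = x := by
    refine eval_guessedE ?_ hg
    rw [hs₄, eval_var N (by decide), hv₃ 8 (by decide) (by decide), h8]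
  have hev : coverS.eval N s = (fill 1 20 (ite sepE guessedE (const 1))).eval N s₄ := rfl
  rw [hev, fill_arr_self _ _ _ _ hx]
  have hex : (∃ j < g, s₄.arr 7 j = x) ↔
      ∃ j < g, ofDigits (fun m => s.arr 2 (T + (j * l + m))) l = x := by
    refine exists_congr fun j => and_congr_right fun hj => ?_
    rw [hdec j (by omega)]
  rw [← hex, ← hguess, ← hsep x hx hJN, ← hsep₄, SumExpr.eval]
  by_cases h : sepE.eval N (s₄.setVar 20 x) = 0
  · simp [h, SumExpr.eval]
  · simp [h]

end Covering

namespace Covering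

/-! ### Estimates for the parameters -/

theorem lt_card_filter_range_iff {p : ℕ → Prop} [DecidablePred p]
    (hp : ∀ i j, j ≤ i → p i → p j) (n i : ℕ) :
    i < ({i ∈ Finset.range n | p i}).card ↔ i < n ∧ p i := by
  have key : {i ∈ Finset.range n | p i} = Finset.range ({i ∈ Finset.range n | p i}).card := by
    induction n with
    | zero => simp
    | succ n ih =>
      rw [Finset.range_add_one, Finset.filter_insert]
      split_ifs with h
      · have hall : {i ∈ Finset.range n | p i} = Finset.range n := by
          rw [Finset.filter_eq_self]
          exact fun i hi => hp n i (Finset.mem_range.1 hi).le h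
        rw [hall, Finset.card_insert_of_notMem (by simp), Finset.card_range,
          Finset.range_add_one]
      · exact ih
  rw [← Finset.mem_range, ← key]
  simp

theorem lt_root_iff {d n k i : ℕ} : i < root d n k ↔ i < n ∧ (i + 1) ^ d ≤ k :=
  lt_card_filter_range_iff (fun i j hji h => (Nat.pow_le_pow_left (by omega) d).trans h) n i

theorem lt_growth_iff {N q l i : ℕ} : i < growth N q l ↔ i < N ∧ i * l < q :=
  lt_card_filter_range_iff (fun _ _ hji h => (Nat.mul_le_mul_right l hji).trans_lt h) N i

theorem lt_guesses_iff {N M k i : ℕ} : i < guesses N M k ↔ i < N ∧ M * i < 3 * k :=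
  lt_card_filter_range_iff (fun _ _ hji h => (Nat.mul_le_mul_left M hji).trans_lt h) N i

theorem root_le (d n k : ℕ) : root d n k ≤ n :=
  (Finset.card_filter_le _ _).trans (Finset.card_range n).le

theorem root_pos {d n k : ℕ} (hn : 1 ≤ n) (hk : 1 ≤ k) : 1 ≤ root d n k :=
  lt_root_iff.2 ⟨hn, by simpa using hk⟩

theorem growth_pos {N q l : ℕ} (hN : 1 ≤ N) (hq : 1 ≤ q) : 1 ≤ growth N q l :=
  lt_growth_iff.2 ⟨hN, by omega⟩

theorem growth_mul_lt {N q l : ℕ} (hl : 1 ≤ l) : growth N q l * l < q + l := by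
  rcases Nat.eq_zero_or_pos (growth N q l) with h | h
  · rw [h]; omega
  · have h1 := (lt_growth_iff (N := N) (q := q) (l := l)).1 (Nat.sub_lt h one_pos)
    have h2 : growth N q l * l = (growth N q l - 1) * l + l := by
      rw [← Nat.succ_mul]; congr 1; omega
    omega

theorem le_growth_mul {N q l : ℕ} (hl : 1 ≤ l) (hq : q ≤ N) : q ≤ growth N q l * l := by
  have h := mt (lt_growth_iff (N := N) (q := q) (l := l)).2 (lt_irrefl _)
  rw [not_and_or] at h
  rcases h with h | h
  · nlinarith
  · omega

theorem le_guesses {N M k m : ℕ} (hM : 1 ≤ M) (hm : m ≤ N) (h : M * m ≤ 3 * k) :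
    m ≤ guesses N M k := by
  rcases Nat.eq_zero_or_pos m with rfl | h0
  · exact Nat.zero_le _
  · have : m - 1 < guesses N M k := by
      refine lt_guesses_iff.2 ⟨by omega, ?_⟩
      have : M * m = M * (m - 1) + M := by
        rw [← Nat.mul_succ]; congr 1; omega
      omega
    omega

theorem guesses_mul_le (N M k : ℕ) : M * guesses N M k ≤ 3 * k + M := by
  rcases Nat.eq_zero_or_pos (guesses N M k) with h | h
  · rw [h]; omega
  · have h1 := (lt_guesses_iff (N := N) (M := M) (k := k)).1 (Nat.sub_lt h one_pos)
    have h2 : M * guesses N M k = M * (guesses N M k - 1) + M := by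
      rw [← Nat.mul_succ]; congr 1; omega
    omega

/-! ### Tossing coins -/

/-- Toss as many coins as variable `9` says and store them in the array `2`. -/
def flipLoop : RProg :=
  .loop (.sub (.var 9) (.var 13)) (.seq (.flip 14) (.seq (.store 2 (.var 13) (.var 14))
    (.assign 13 (.add (.var 13) (.const 1)))))

/-- The effect of one toss. -/
def toss (s : Memory) (c : Bool) : Memory :=
  ((s.setVar 14 (if c then 1 else 0)).setArr 2 (s.var 13) (if c then 1 else 0)).setVar 13
    (s.var 13 + 1)

theorem run_flipLoop_step {s : Memory} (h : s.var 13 < s.var 9) (K : List RProg) :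
    RConfig.run 6 ⟨flipLoop :: K, s⟩ =
      (PMF.uniformOfFintype Bool).map fun c => ⟨flipLoop :: K, toss s c⟩ := by
  have h' : ¬ s.var 9 ≤ s.var 13 := by omega
  simp [flipLoop, RConfig.run, RConfig.step, RExpr.eval, Nat.sub_eq_zero_iff_le, h', toss, PMF.map]
  rfl

theorem run_flipLoop (K : List RProg) (m : ℕ) {s : Memory} (h : s.var 9 = s.var 13 + m) :
    (∀ C ∈ (RConfig.run (6 * m + 1) ⟨flipLoop :: K, s⟩).support,
      ∃ l : List Bool, l.length = m ∧ C = ⟨K, l.foldl toss s⟩) ∧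
    ∀ l : List Bool, l.length = m →
      (2⁻¹ : ENNReal) ^ m ≤ RConfig.run (6 * m + 1) ⟨flipLoop :: K, s⟩ ⟨K, l.foldl toss s⟩ := by
  induction m generalizing s with
  | zero =>
    have hrun : RConfig.run (6 * 0 + 1) ⟨flipLoop :: K, s⟩ = PMF.pure ⟨K, s⟩ := by
      simp [flipLoop, RConfig.run, RConfig.step, RExpr.eval, h]
    rw [hrun]
    refine ⟨fun C hC => ⟨[], rfl, by simpa using hC⟩, fun l hl => ?_⟩
    rw [List.length_eq_zero_iff.1 hl]
    simp
  | succ m ih =>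
    have hrun : RConfig.run (6 * (m + 1) + 1) ⟨flipLoop :: K, s⟩ =
        (PMF.uniformOfFintype Bool).bind fun c =>
          RConfig.run (6 * m + 1) ⟨flipLoop :: K, toss s c⟩ := by
      rw [show 6 * (m + 1) + 1 = 6 + (6 * m + 1) by ring, RConfig.run_add,
        run_flipLoop_step (by omega), PMF.bind_map]
      rfl
    have hc : ∀ c, (toss s c).var 9 = (toss s c).var 13 + m := by
      intro c
      simp [toss, h]
      omega
    rw [hrun]
    constructor
    · intro C hC
      rw [PMF.mem_support_bind_iff] at hC
      obtain ⟨c, -, hC⟩ := hC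
      obtain ⟨l, hl, rfl⟩ := (ih (hc c)).1 C hC
      exact ⟨c :: l, by simp [hl], rfl⟩
    · intro l hl
      obtain ⟨c, l, rfl⟩ := List.exists_cons_of_length_eq_add_one hl
      have h1 := (ih (hc c)).2 l (by simpa using hl)
      rw [PMF.bind_apply, pow_succ']
      refine le_trans ?_ (ENNReal.le_tsum c)
      rw [PMF.uniformOfFintype_apply, Fintype.card_bool]
      exact mul_le_mul' (by simp) h1

theorem foldl_toss_var (l : List Bool) (s : Memory) {x : ℕ} (h13 : x ≠ 13) (h14 : x ≠ 14) :
    (l.foldl toss s).var x = s.var x := by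
  induction l generalizing s with
  | nil => rfl
  | cons c l ih => rw [List.foldl_cons, ih]; simp [toss, h13, h14]

theorem foldl_toss_arr (l : List Bool) (s : Memory) {a : ℕ} (h2 : a ≠ 2) :
    (l.foldl toss s).arr a = s.arr a := by
  induction l generalizing s with
  | nil => rfl
  | cons c l ih => rw [List.foldl_cons, ih]; funext i; simp [toss, h2]

/-- The coins of a list as numbers. -/
def coin (l : List Bool) (i : ℕ) : ℕ := if l.getD i false then 1 else 0

theorem foldl_toss_coin (l : List Bool) (s : Memory) :
    (∀ i < s.var 13, (l.foldl toss s).arr 2 i = s.arr 2 i) ∧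
      ∀ i < l.length, (l.foldl toss s).arr 2 (s.var 13 + i) = coin l i := by
  induction l generalizing s with
  | nil => simp
  | cons c l ih =>
    obtain ⟨h1, h2⟩ := ih (toss s c)
    have h13 : (toss s c).var 13 = s.var 13 + 1 := by simp [toss]
    rw [h13] at h1 h2
    simp only [List.foldl_cons]
    refine ⟨fun i hi => ?_, fun i hi => ?_⟩
    · rw [h1 i (by omega)]
      simp [toss, show i ≠ s.var 13 by omega]
    · rcases i with - | i
      · rw [Nat.add_zero, h1 _ (by omega)]
        simp [toss, coin]
      · rw [show s.var 13 + (i + 1) = s.var 13 + 1 + i by ring, h2 i (by simpa using hi)]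
        simp [coin]

theorem sum_coin_le (l : List Bool) (T : ℕ) : ∑ i ∈ Finset.range T, coin l i ≤ T := by
  have := Finset.sum_le_card_nsmul (Finset.range T) (coin l) 1
    (fun i _ => by unfold coin; split_ifs <;> simp)
  simpa using this

/-! ### The whole program -/

/-- The set that the program outputs if the coins show `l`. -/
def coverSet {n : ℕ} (G : SimpleGraph (Fin n)) (M N b g : ℕ) (l : List Bool) : Set (Fin n) :=
  {v | (v : ℕ) ∉ boundary (natAdj G) M N n ((reweight (natAdj G) M N n)^[∑ i ∈ Finset.range (M * b),
      coin l i] fun _ => 1) ∨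
    ∃ j < g, ofDigits (fun m => coin l (M * b + (j * b + m))) b = v}

/-- The covering program. -/
def program (d : ℕ) : RProg :=
  .seq (.seq (.assign 2 (.add (.add (.var 0) (.var 0)) (.const 2))) ((setup d).compile 100))
    (.seq flipLoop (coverS.compile 100))

/-- A bound for the number of steps. -/
noncomputable def timeBound (d : ℕ) : Polynomial ℕ :=
  ((setup d).cost + coverS.cost + 12 * Polynomial.X ^ 2 + 5).comp (2 * Polynomial.X + 2)

theorem eval_nat_mono (p : Polynomial ℕ) {a b : ℕ} (h : a ≤ b) : p.eval a ≤ p.eval b := by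
  rw [Polynomial.eval_eq_sum_range, Polynomial.eval_eq_sum_range]
  gcongr

theorem inputMemory_arr_zero {n : ℕ} (G : SimpleGraph (Fin n)) [DecidableRel G.Adj] (k : ℕ)
    {y x : ℕ} (hx : x < n) :
    (inputMemory G k).arr 0 (y * n + x) ≠ 0 ↔ natAdj G y x := by
  simp only [inputMemory, true_and, ne_eq, ite_eq_right_iff, one_ne_zero, imp_false, not_not]
  constructor
  · rintro ⟨u, v, h, hadj⟩
    have h1 : x = v := by
      have := congrArg (· % n) h
      simpa [Nat.mul_add_mod', Nat.mod_eq_of_lt hx, Nat.mod_eq_of_lt v.2] using this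
    refine ⟨u, v, ?_, h1, hadj⟩
    have h2 : y * n = u * n := by omega
    exact Nat.eq_of_mul_eq_mul_right (by omega) h2
  · rintro ⟨u, v, rfl, rfl, hadj⟩
    exact ⟨u, v, rfl, hadj⟩

theorem program_spec (d : ℕ) {n k : ℕ} (hn : 1 ≤ n) (G : SimpleGraph (Fin n))
    [DecidableRel G.Adj] :
    ∃ b, n < 2 ^ b ∧ 2 ^ b ≤ 2 * n ∧ ∀ N M g, N = 2 * n + 2 → M = growth N (root d n k) b →
      g = guesses N M k →
      (program d).HaltsWithin G k ((timeBound d).eval (inputLength n k)) ∧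
      (∀ A ∈ ((program d).outputDist G k ((timeBound d).eval (inputLength n k))).support,
        ∃ l, A = coverSet G M N b g l) ∧
      ∀ l : List Bool, l.length = M * b + g * b → ∀ X : Set (Fin n), X ⊆ coverSet G M N b g l →
        (2⁻¹ : ENNReal) ^ (M * b + g * b) ≤
          ((program d).outputDist G k ((timeBound d).eval (inputLength n k))).toOuterMeasure
            {A | X ⊆ A} := by
  set s₁ := (inputMemory G k).setVar 2 (2 * n + 2) with hs₁
  obtain ⟨b, hb1, hb2, e3, e6, e7, e8, e9⟩ := setup_spec (d := d) (N := 2 * n + 2) (s := s₁) hn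
    (by omega) (k := k) (by simp [hs₁, inputMemory]) (by simp [hs₁, inputMemory])
    (by simp [hs₁, inputMemory])
  refine ⟨b, hb1, hb2, ?_⟩
  rintro N M g hN hM hg
  rw [← hN] at hs₁ e3 e6 e7 e8 e9
  rw [← hM] at e6 e7 e8 e9
  rw [← hg] at e8 e9
  have hvars : ∀ x, x ∉ [4, 3, 5, 6, 7, 8, 9] → ((setup d).eval N s₁).var x = s₁.var x :=
    fun x hx => SumStmt.eval_var N (by simp [setup, SumStmt.vars] at hx ⊢; tauto) s₁
  have harrs : ∀ a, ((setup d).eval N s₁).arr a = s₁.arr a :=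
    fun a => SumStmt.eval_arr N (by simp [setup, SumStmt.arrs]) s₁
  have hbn : b ≤ n := by
    rcases b with - | b
    · omega
    · have : b < 2 ^ b := Nat.lt_two_pow_self
      rw [pow_succ] at hb2
      omega
  have hb0 : 1 ≤ b := by
    rcases b with - | b
    · simp at hb1; omega
    · omega
  have hq := root_le d n k
  have hMN : M ≤ N := hM ▸ growth_le _ _ _
  have hgN : g ≤ N := hg ▸ guesses_le _ _ _
  have hT : M * b < N := by
    have := growth_mul_lt (N := N) (q := root d n k) hb0
    rw [← hM] at this
    omega
  have hA : (RProg.seq (.assign 2 (.add (.add (.var 0) (.var 0)) (.const 2)))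
      ((setup d).compile 100)).Runs (inputMemory G k) (1 + (setup d).cost.eval N + 1)
        fun s' => s'.Agree ((setup d).eval N s₁) := by
    refine (RProg.runs_assign (Q := fun s' => s' = s₁) ?_).seq ?_
    · rw [hs₁, hN]
      simp [RExpr.eval, inputMemory]
      ring_nf
    · rintro s' rfl
      exact (SumStmt.runs_compile (setup_wf d) le_rfl (by simp [hs₁])).mono le_rfl fun _ h => h.1
  obtain ⟨tA, htA, s₂, hexecA, hag⟩ := hA
  have v0 : s₂.var 0 = n := by
    rw [hag.var 0 (by decide), hvars 0 (by decide)]; simp [hs₁, inputMemory]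
  have v2 : s₂.var 2 = N := by
    rw [hag.var 2 (by decide), hvars 2 (by decide)]; simp [hs₁]
  have v3 : s₂.var 3 = b := by rw [hag.var 3 (by decide), e3]
  have v6 : s₂.var 6 = M := by rw [hag.var 6 (by decide), e6]
  have v7 : s₂.var 7 = M * b := by rw [hag.var 7 (by decide), e7]
  have v8 : s₂.var 8 = g := by rw [hag.var 8 (by decide), e8]
  have v9 : s₂.var 9 = M * b + g * b := by rw [hag.var 9 (by decide), e9]
  have vz : ∀ x, x = 11 ∨ x = 12 ∨ x = 13 → s₂.var x = 0 := by
    intro x hx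
    rw [hag.var x (by omega), hvars x (by rcases hx with rfl | rfl | rfl <;> decide)]
    rcases hx with rfl | rfl | rfl <;> simp [hs₁, inputMemory]
  have a0 : s₂.arr 0 = (inputMemory G k).arr 0 := by
    rw [hag.arr 0 (by decide), harrs]; rfl
  have a7 : ∀ x, s₂.arr 7 x = 0 := by
    intro x
    rw [hag.arr 7 (by decide), harrs]; simp [hs₁, inputMemory]
  set m := M * b + g * b with hm
  obtain ⟨hsupp, hprob⟩ := run_flipLoop [coverS.compile 100] m (s := s₂)
    (by rw [v9, vz 13 (by simp)]; omega)
  have hcover : ∀ l : List Bool, l.length = m → ∃ s', ((coverS.compile 100).Runs (l.foldl toss s₂)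
      (coverS.cost.eval N) fun t => t = s') ∧ s'.outputSet n = coverSet G M N b g l := by
    intro l hl
    set s₃ := l.foldl toss s₂
    have hv : ∀ x, x ≠ 13 → x ≠ 14 → s₃.var x = s₂.var x := fun x h h' => foldl_toss_var l s₂ h h'
    have hcoin : ∀ i < m, s₃.arr 2 i = coin l i := by
      intro i hi
      have := (foldl_toss_coin l s₂).2 i (by omega)
      rwa [vz 13 (by simp), Nat.zero_add] at this
    obtain ⟨t, ht, s', hex, hs'⟩ := SumStmt.runs_compile coverS_wf (le_refl 100) (s := s₃) (N := N)
      (by rw [hv 2 (by decide) (by decide), v2])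
    refine ⟨s', ⟨t, ht, s', hex, rfl⟩, ?_⟩
    have hsum : ∑ i ∈ Finset.range (M * b), s₃.arr 2 i =
        ∑ i ∈ Finset.range (M * b), coin l i :=
      Finset.sum_congr rfl fun i hi => hcoin i (by have := Finset.mem_range.1 hi; omega)
    ext v
    have hvn := v.2
    have hspec := coverS_spec (adj := natAdj G) (s := s₃) (n := n) (M := M) (N := N) (l := b)
      (T := M * b) (g := g) (x := v) (by omega) hMN hT (by omega) hgN
      (by rw [hv 0 (by decide) (by decide), v0]) (by rw [hv 3 (by decide) (by decide), v3])
      (by rw [hv 6 (by decide) (by decide), v6]) (by rw [hv 7 (by decide) (by decide), v7])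
      (by rw [hv 8 (by decide) (by decide), v8])
      (by rw [hv 11 (by decide) (by decide), vz 11 (by simp)])
      (by rw [hv 12 (by decide) (by decide), vz 12 (by simp)])
      (fun y _ x hx => by
        rw [foldl_toss_arr l s₂ (by decide), a0]; exact inputMemory_arr_zero G k hx)
      (fun x _ => by rw [foldl_toss_arr l s₂ (by decide), a7]) hsum
      ((sum_coin_le l _).trans_lt hT) (by omega)
    have h1 : s'.arr 1 = (coverS.eval N s₃).arr 1 := hs'.1.arr 1 (by decide)
    simp only [Memory.outputSet, coverSet, Set.mem_ofPred_eq, h1]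
    rw [hspec]
    refine or_congr_right (exists_congr fun j => and_congr_right fun hj => ?_)
    rw [ofDigits_congr fun i hi => hcoin _ ?_]
    have : j * b + b ≤ g * b := by
      rw [← Nat.succ_mul]; exact Nat.mul_le_mul_right b hj
    omega
  have hlen : n ≤ inputLength n k := by
    unfold inputLength
    nlinarith
  have hNle : N ≤ 2 * inputLength n k + 2 := by omega
  obtain ⟨u, hu, hut⟩ : ∃ u, (timeBound d).eval (inputLength n k) =
      1 + (tA + (1 + ((6 * m + 1) + u))) ∧ coverS.cost.eval N ≤ u := by
    have h1 : (timeBound d).eval (inputLength n k) = (setup d).cost.eval (2 * inputLength n k + 2)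
        + coverS.cost.eval (2 * inputLength n k + 2) + 12 * (2 * inputLength n k + 2) ^ 2 + 5 := by
      simp [timeBound]
    have h2 := eval_nat_mono (setup d).cost hNle
    have h3 := eval_nat_mono coverS.cost hNle
    have h4 : N ^ 2 ≤ (2 * inputLength n k + 2) ^ 2 := Nat.pow_le_pow_left hNle 2
    have h5 : m ≤ 2 * N ^ 2 := by
      rw [hm, pow_two]
      have := Nat.mul_le_mul hMN (show b ≤ N by omega)
      have := Nat.mul_le_mul hgN (show b ≤ N by omega)
      omega
    exact ⟨(timeBound d).eval (inputLength n k) - (1 + (tA + (1 + (6 * m + 1)))), by omega,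
      by omega⟩
  have hrun : RConfig.run ((timeBound d).eval (inputLength n k)) ⟨[program d], inputMemory G k⟩ =
      (RConfig.run (6 * m + 1) ⟨[flipLoop, coverS.compile 100], s₂⟩).bind (RConfig.run u) := by
    rw [hu, RConfig.run_add]
    have h1 : RConfig.run 1 ⟨[program d], inputMemory G k⟩ = PMF.pure
        ⟨[.seq (.assign 2 (.add (.add (.var 0) (.var 0)) (.const 2))) ((setup d).compile 100),
          .seq flipLoop (coverS.compile 100)], inputMemory G k⟩ := by
      simp [program, RConfig.run, RConfig.step]
    have h2 : RConfig.run 1 ⟨[.seq flipLoop (coverS.compile 100)], s₂⟩ = PMF.pure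
        ⟨[flipLoop, coverS.compile 100], s₂⟩ := by
      simp [RConfig.run, RConfig.step]
    rw [h1, PMF.pure_bind, RConfig.run_add, hexecA, PMF.pure_bind, RConfig.run_add, h2,
      PMF.pure_bind, RConfig.run_add]
  have hfinal : ∀ l : List Bool, l.length = m → ∃ s',
      RConfig.run u ⟨[coverS.compile 100], l.foldl toss s₂⟩ = PMF.pure ⟨[], s'⟩ ∧
        s'.outputSet n = coverSet G M N b g l := by
    intro l hl
    obtain ⟨s', ⟨t, ht, _, hex, rfl⟩, hout⟩ := hcover l hl
    refine ⟨_, ?_, hout⟩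
    obtain ⟨r, rfl⟩ := Nat.exists_eq_add_of_le (ht.trans hut)
    rw [RConfig.run_add, hex, PMF.pure_bind, RConfig.run_halted]
  have hsupport : ∀ C ∈ (RConfig.run ((timeBound d).eval (inputLength n k))
      ⟨[program d], inputMemory G k⟩).support,
      C.todo = [] ∧ ∃ l, C.mem.outputSet n = coverSet G M N b g l := by
    intro C hC
    rw [hrun, PMF.mem_support_bind_iff] at hC
    obtain ⟨C', hC', hC⟩ := hC
    obtain ⟨l, hl, rfl⟩ := hsupp C' hC'
    obtain ⟨s', hs', hout⟩ := hfinal l hl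
    rw [hs', PMF.mem_support_pure_iff] at hC
    subst hC
    exact ⟨rfl, l, hout⟩
  refine ⟨fun C hC => (hsupport C hC).1, ?_, ?_⟩
  · intro A hA
    rw [RProg.outputDist, PMF.mem_support_map_iff] at hA
    obtain ⟨C, hC, rfl⟩ := hA
    exact (hsupport C hC).2
  · intro l hl X hX
    obtain ⟨s', hs', hout⟩ := hfinal l hl
    rw [RProg.outputDist, PMF.toOuterMeasure_map_apply]
    have hmem : (⟨[], s'⟩ : RConfig) ∈ (fun C : RConfig => C.mem.outputSet n) ⁻¹' {A | X ⊆ A} := by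
      simpa [hout] using hX
    calc (2⁻¹ : ENNReal) ^ m
        ≤ RConfig.run (6 * m + 1) ⟨[flipLoop, coverS.compile 100], s₂⟩
            ⟨[coverS.compile 100], l.foldl toss s₂⟩ := hprob l hl
      _ ≤ RConfig.run ((timeBound d).eval (inputLength n k)) ⟨[program d], inputMemory G k⟩
            ⟨[], s'⟩ := by
          rw [hrun, PMF.bind_apply]
          refine le_trans ?_ (ENNReal.le_tsum ⟨[coverS.compile 100], l.foldl toss s₂⟩)
          rw [hs']
          simp
      _ ≤ _ := by
          rw [← PMF.toOuterMeasure_apply_singleton]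
          exact MeasureTheory.measure_mono (Set.singleton_subset_iff.2 hmem)

end Covering

namespace Covering

/-- For every small set of vertices there are coins for which the output contains it. -/
theorem exists_coins {n k N M b : ℕ} (G : SimpleGraph (Fin n)) (hM : 1 ≤ M) (hb0 : 1 ≤ b)
    (hb : n < 2 ^ b) (hT : M * b ≤ N) (hn : n ≤ N) {X : Finset (Fin n)} (hX : X.card ≤ k) :
    ∃ l : List Bool, l.length = M * b + guesses N M k * b ∧
      (X : Set (Fin n)) ⊆ coverSet G M N b (guesses N M k) l := by
  classical
  set Z : Finset ℕ := X.map Fin.valEmbedding with hZ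
  have hZn : Z ⊆ Finset.range n := by
    intro x hx
    simp only [hZ, Finset.mem_map, Fin.valEmbedding_apply] at hx
    obtain ⟨v, -, rfl⟩ := hx
    exact Finset.mem_range.2 v.2
  obtain ⟨t, ht, hround⟩ := exists_round (natAdj_symm G) hM hb0 hb hT hn hZn
  set E := boundary (natAdj G) M N n ((reweight (natAdj G) M N n)^[t] fun _ => 1)
  set Y := Z ∩ E
  have hYn : Y.card ≤ n := by
    simpa using Finset.card_le_card (Finset.inter_subset_left.trans hZn : Y ⊆ Finset.range n)
  have hYg : Y.card ≤ guesses N M k := by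
    refine le_guesses hM (hYn.trans hn) (hround.trans ?_)
    rw [hZ, Finset.card_map]
    omega
  let f : ℕ → Bool := fun i => if i < M * b then decide (i < t) else
    decide (Y.toList.getD ((i - M * b) / b) 0 / 2 ^ (b - 1 - (i - M * b) % b) % 2 = 1)
  refine ⟨(List.range (M * b + guesses N M k * b)).map f, by simp, ?_⟩
  have hcoin : ∀ i < M * b + guesses N M k * b,
      coin ((List.range (M * b + guesses N M k * b)).map f) i = if f i then 1 else 0 := by
    intro i hi
    simp [coin, List.getD, hi]
  have hsum : ∑ i ∈ Finset.range (M * b),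
      coin ((List.range (M * b + guesses N M k * b)).map f) i = t := by
    calc _ = ∑ i ∈ Finset.range (M * b), if i < t then 1 else 0 := by
          refine Finset.sum_congr rfl fun i hi => ?_
          have hi := Finset.mem_range.1 hi
          rw [hcoin i (by omega)]
          simp [f, hi]
      _ = t := by
          rw [← Finset.sum_filter, Finset.sum_const, smul_eq_mul, mul_one,
            show (Finset.range (M * b)).filter (· < t) = Finset.range t by ext; simp; omega,
            Finset.card_range]
  intro v hv
  rw [coverSet, Set.mem_ofPred_eq, hsum]
  by_cases hvE : (v : ℕ) ∈ E
  · right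
    have hvY : (v : ℕ) ∈ Y.toList := by
      rw [Finset.mem_toList, Finset.mem_inter]
      exact ⟨Finset.mem_map.2 ⟨v, hv, rfl⟩, hvE⟩
    obtain ⟨j, hj, hjv⟩ := List.getElem_of_mem hvY
    rw [Finset.length_toList] at hj
    refine ⟨j, by omega, ?_⟩
    rw [← ofDigits_div_mod (v := v) (l := b) (v.2.trans hb)]
    refine ofDigits_congr fun i hi => ?_
    have hjb : j * b + b ≤ guesses N M k * b := by
      rw [← Nat.succ_mul]; exact Nat.mul_le_mul_right b (by omega)
    rw [hcoin _ (by omega)]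
    have h1 : (j * b + i) / b = j := by
      rw [mul_comm, Nat.mul_add_div (by omega), Nat.div_eq_of_lt hi, add_zero]
    have h2 : (j * b + i) % b = i := by
      rw [Nat.mul_add_mod', Nat.mod_eq_of_lt hi]
    have h3 : Y.toList.getD j 0 = v := by
      rw [List.getD_eq_getElem _ _ (by simpa using hj), hjv]
    simp only [f, Nat.add_sub_cancel_left, h1, h2, h3,
      show ¬ (M * b + (j * b + i) < M * b) by omega,
      if_false, decide_eq_true_eq]
    split_ifs <;> omega
  · exact Or.inl hvE

/-- The estimates for the number of bits `b`, the radius `M * b` of the clusters and the number of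
guessed vertices. -/
theorem exists_parameter_bounds (e : ℕ) (he : 1 ≤ e) (D F : ℕ) (hF : 1 ≤ F) (c : ℝ) (hc : 0 < c) :
    ∃ R : ℝ, 1 ≤ R ∧ ∀ k n r b N M : ℕ, 4 ≤ k → 1 ≤ n → n ≤ F * (2 * D * r + 1) ^ (e + 1) →
      (r : ℝ) ≤ c * k * Real.log k → 2 ^ b ≤ 2 * n → 1 ≤ b → N = 2 * n + 2 →
      M = growth N (root (e + 1) n k) b →
      (b : ℝ) ≤ R * Real.log k ∧ ((M * b : ℕ) : ℝ) ≤ R * (k : ℝ) ^ (1 / ((e + 1 : ℕ) : ℝ)) ∧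
      (guesses N M k : ℝ) ≤ R * ((k : ℝ) ^ (1 / ((e + 1 : ℕ) : ℝ))) ^ e * Real.log k := by
  set H : ℝ := (Real.log 2 + Real.log F + (e + 1) * Real.log (2 * D * c + 1) + 2 * (e + 1)) /
    Real.log 2 with hH
  have hlog2 : 0 < Real.log 2 := Real.log_pos (by norm_num)
  have hlogF : 0 ≤ Real.log F := Real.log_natCast_nonneg F
  have hlogc : 0 ≤ Real.log (2 * D * c + 1) := Real.log_nonneg (by
    have : 0 ≤ 2 * (D : ℝ) * c := by positivity
    linarith)
  have hH1 : 1 ≤ H := by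
    rw [hH, le_div_iff₀ hlog2]
    nlinarith
  refine ⟨6 * H + 5 + H * (e + 1), by nlinarith, ?_⟩
  intro k n r b N M hk hn hnr hr hb hb0 hN hM
  have hk4 : (4 : ℝ) ≤ k := by exact_mod_cast hk
  have hk0 : (0 : ℝ) < k := by linarith
  have hlogk : 1 ≤ Real.log k := by
    have h1 : Real.log 4 = 2 * Real.log 2 := by
      rw [show (4 : ℝ) = 2 ^ 2 by norm_num, Real.log_pow]; norm_num
    have h2 := Real.log_le_log (by norm_num) hk4
    have h3 := Real.log_two_gt_d9
    linarith
  set κ : ℝ := (k : ℝ) ^ (1 / ((e + 1 : ℕ) : ℝ)) with hκ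
  have hκ1 : 1 ≤ κ := Real.one_le_rpow (by linarith) (by positivity)
  have hκk : κ ^ (e + 1) = k := by
    rw [hκ, ← Real.rpow_natCast, ← Real.rpow_mul hk0.le, one_div, inv_mul_cancel₀ (by positivity),
      Real.rpow_one]
  have hlogκ : Real.log k ≤ (e + 1) * κ := by
    rw [← hκk, Real.log_pow]
    push_cast
    have := Real.log_le_self (show 0 ≤ κ by linarith)
    gcongr
  have hbH : (b : ℝ) ≤ H * Real.log k := by
    have hn0 : (0 : ℝ) < n := by exact_mod_cast hn
    have h1 : (b : ℝ) * Real.log 2 ≤ Real.log 2 + Real.log n := by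
      rw [← Real.log_pow, ← Real.log_mul (by norm_num) hn0.ne']
      refine Real.log_le_log (by positivity) ?_
      exact_mod_cast hb
    have h2 : (2 * D * r + 1 : ℝ) ≤ (2 * D * c + 1) * (k : ℝ) ^ 2 := by
      have h3 : (r : ℝ) ≤ c * (k : ℝ) ^ 2 := by
        have := Real.log_le_self hk0.le
        calc (r : ℝ) ≤ c * k * Real.log k := hr
          _ ≤ c * k * k := by gcongr
          _ = c * (k : ℝ) ^ 2 := by ring
      have h4 : 2 * (D : ℝ) * r ≤ 2 * D * (c * (k : ℝ) ^ 2) := by gcongr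
      nlinarith
    have h5 : Real.log n ≤ Real.log F + (e + 1) * (Real.log (2 * D * c + 1) + 2 * Real.log k) := by
      have h6 : (n : ℝ) ≤ F * ((2 * D * c + 1) * (k : ℝ) ^ 2) ^ (e + 1) := by
        calc (n : ℝ) ≤ F * (2 * D * r + 1) ^ (e + 1) := by exact_mod_cast hnr
          _ ≤ _ := by gcongr
      have hF0 : (0 : ℝ) < F := by exact_mod_cast hF
      have hc0 : (0 : ℝ) < 2 * D * c + 1 := by positivity
      have h7 := Real.log_le_log hn0 h6
      rw [Real.log_mul hF0.ne' (by positivity), Real.log_pow,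
        Real.log_mul hc0.ne' (by positivity), Real.log_pow] at h7
      push_cast at h7
      exact h7
    rw [hH, div_mul_eq_mul_div, le_div_iff₀ hlog2]
    have h8 : 0 ≤ (Real.log 2 + Real.log F + (e + 1) * Real.log (2 * D * c + 1)) *
        (Real.log k - 1) := mul_nonneg (by positivity) (by linarith)
    nlinarith
  have hq0 : 1 ≤ root (e + 1) n k := root_pos hn (by omega)
  set q := root (e + 1) n k with hq
  have hqn : q ≤ n := root_le _ _ _
  have hqκ : (q : ℝ) ≤ κ := by
    have h1 := ((lt_root_iff (d := e + 1) (n := n) (k := k)).1 (Nat.sub_lt hq0 one_pos)).2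
    rw [← hq, Nat.sub_add_cancel hq0] at h1
    have h2 : (q : ℝ) ^ (e + 1) ≤ κ ^ (e + 1) := by rw [hκk]; exact_mod_cast h1
    exact le_of_pow_le_pow_left₀ (by omega) (by linarith) h2
  have hM1 : 1 ≤ M := hM ▸ growth_pos (by omega) hq0
  have hpow : κ ≤ κ ^ e := le_self_pow₀ hκ1 (by omega)
  have hpow1 : 1 ≤ κ ^ e := one_le_pow₀ hκ1
  refine ⟨?_, ?_, ?_⟩
  · refine hbH.trans ?_
    gcongr
    nlinarith
  · have h1 : M * b < q + b := hM ▸ growth_mul_lt hb0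
    have h2 : ((M * b : ℕ) : ℝ) ≤ q + b := by exact_mod_cast h1.le
    have h3 : H * Real.log k ≤ H * ((e + 1) * κ) := by gcongr
    nlinarith
  · have hgoal : (guesses N M k : ℝ) ≤ (6 * H + 5) * (κ ^ e * Real.log k) := by
      have hel : 1 ≤ κ ^ e * Real.log k := by nlinarith
      by_cases hqn' : q = n
      · have h1 : (guesses N M k : ℝ) ≤ 2 * n + 2 := by
          have := guesses_le N M k
          rw [hN] at this ⊢
          exact_mod_cast this
        have h2 : (1 : ℝ) ≤ q := by exact_mod_cast hq0
        rw [← hqn'] at h1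
        have h3 : κ ^ e ≤ κ ^ e * Real.log k := le_mul_of_one_le_right (by linarith) hlogk
        nlinarith
      · have h1 : ¬ q < q := lt_irrefl q
        rw [hq, lt_root_iff, ← hq] at h1
        have h2 : k < (q + 1) ^ (e + 1) := by
          by_contra hcon
          exact h1 ⟨by omega, by omega⟩
        have h3 : κ < q + 1 := by
          have : κ ^ (e + 1) < ((q : ℝ) + 1) ^ (e + 1) := by rw [hκk]; exact_mod_cast h2
          exact lt_of_pow_lt_pow_left₀ _ (by positivity) this
        have h4 : q ≤ M * b := hM ▸ le_growth_mul hb0 (by omega)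
        have h5 : κ ≤ 2 * (M * b) := by
          have h6 : (q : ℝ) ≤ M * b := by exact_mod_cast h4
          have h7 : (1 : ℝ) ≤ q := by exact_mod_cast hq0
          linarith
        have h8 : (M : ℝ) * guesses N M k ≤ 3 * k + M := by exact_mod_cast guesses_mul_le N M k
        have hM0 : (0 : ℝ) < M := by exact_mod_cast hM1
        have h9 : (3 : ℝ) * k ≤ M * (6 * (κ ^ e * b)) := by
          rw [← hκk, pow_succ]
          have : κ ^ e * κ ≤ κ ^ e * (2 * (M * b)) := by gcongr
          linarith
        have h10 : (guesses N M k : ℝ) ≤ 6 * (κ ^ e * b) + 1 := by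
          refine le_of_mul_le_mul_left ?_ hM0
          linarith
        have h11 : κ ^ e * b ≤ κ ^ e * (H * Real.log k) := by gcongr
        nlinarith
    have hHe : 0 ≤ H * (e + 1) := by positivity
    refine hgoal.trans ?_
    rw [mul_assoc]
    exact mul_le_mul_of_nonneg_right (by linarith) (by positivity)

end Covering

theorem mainTheorem4 (d : ℕ) (hd : 2 ≤ d) (β : ℝ) (hβ : 1 ≤ β) (Δ : ℕ) (hΔ : 1 ≤ Δ)
    (c : ℝ) (hc : 0 < c) :
    ∃ c' : ℝ, 0 < c' ∧ ∃ K : ℝ, 0 < K ∧ ∃ (P : RProg) (time : Polynomial ℕ),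
      ∀ k : ℕ, 4 ≤ k → ∀ (n : ℕ) (G : SimpleGraph (Fin n)) [DecidableRel G.Adj],
        G.Connected → IsFatIntersectionGraph d β G → G.maxDegree ≤ Δ →
        (∃ r : ℕ, G.radius ≤ r ∧ (r : ℝ) ≤ c * k * Real.log k) →
        P.HaltsWithin G k (time.eval (inputLength n k)) ∧
        (∀ A ∈ (P.outputDist G k (time.eval (inputLength n k))).support,
          (treewidth (G.induce A) : ℝ) ≤ K * (k : ℝ) ^ (1 - 1 / (d : ℝ)) * Real.log k) ∧
        ∀ X : Finset (Fin n), X.card ≤ k →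
          ENNReal.ofReal ((2 : ℝ) ^
            (-(c' * ((X.card : ℝ) + k) * (k : ℝ) ^ (-(1 / (d : ℝ))) * Real.log k ^ 2))) ≤
          (P.outputDist G k (time.eval (inputLength n k))).toOuterMeasure
            {A | (X : Set (Fin n)) ⊆ A} := by
  obtain ⟨e, rfl⟩ : ∃ e, d = e + 1 := ⟨d - 1, by omega⟩
  set D : ℕ := ⌈((e + 1 : ℕ) : ℝ) * (4 * β)⌉₊ + 1 with hD
  obtain ⟨R, hR, hbounds⟩ := Covering.exists_parameter_bounds e (by omega) D (Δ + 1) (by omega) c hc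
  refine ⟨R + R * R, by nlinarith, R + (Δ + 1) * ((D + 1) * (2 * D * R + 1) ^ e), by positivity,
    Covering.program (e + 1), Covering.timeBound (e + 1), ?_⟩
  rintro k hk n G _ hconn hfat hdeg ⟨r, hrad, hr⟩
  have hn : 1 ≤ n := by
    obtain ⟨v⟩ := hconn.nonempty
    have := v.2
    omega
  obtain ⟨g, hg⟩ := hfat.exists_isGridLabelling (by omega) hdeg
  have hcard := hg.card_le_of_radius_le hconn hrad
  rw [Fintype.card_fin] at hcard
  obtain ⟨b, hb1, hb2, hprog⟩ := Covering.program_spec (e + 1) (k := k) hn G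
  obtain ⟨hhalt, hsupp, hprob⟩ := hprog _ _ _ rfl rfl rfl
  set N := 2 * n + 2 with hN
  set M := Covering.growth N (Covering.root (e + 1) n k) b with hM
  have hb0 : 1 ≤ b := by
    rcases b with - | b
    · simp at hb1; omega
    · omega
  obtain ⟨h1, h2, h3⟩ := hbounds k n r b N M hk hn hcard hr hb2 hb0 hN hM
  have hM1 : 1 ≤ M := Covering.growth_pos (by omega) (Covering.root_pos hn (by omega))
  have hbn : b ≤ n := by
    rcases b with - | b
    · omega
    · have : b < 2 ^ b := Nat.lt_two_pow_self
      rw [pow_succ] at hb2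
      omega
  have hT : M * b ≤ N := by
    have h4 := Covering.growth_mul_lt (N := N) (q := Covering.root (e + 1) n k) hb0
    have h5 := Covering.root_le (e + 1) n k
    rw [← hM] at h4
    omega
  have hk4 : (4 : ℝ) ≤ k := by exact_mod_cast hk
  have hk0 : (0 : ℝ) < k := by linarith
  have hlogk : 1 ≤ Real.log k := by
    rw [Real.le_log_iff_exp_le hk0]
    linarith [Real.exp_one_lt_d9]
  set κ : ℝ := (k : ℝ) ^ (1 / ((e + 1 : ℕ) : ℝ)) with hκ
  have hκ1 : 1 ≤ κ := Real.one_le_rpow (by linarith) (by positivity)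
  have hκe : (k : ℝ) ^ (1 - 1 / ((e + 1 : ℕ) : ℝ)) = κ ^ e := by
    rw [hκ, ← Real.rpow_natCast, ← Real.rpow_mul hk0.le]
    congr 1
    push_cast
    field_simp
    ring
  have hpow : κ ≤ κ ^ e := le_self_pow₀ hκ1 (by omega)
  refine ⟨hhalt, fun A hA => ?_, fun X hX => ?_⟩
  · obtain ⟨l, rfl⟩ := hsupp A hA
    obtain ⟨cl, hcl⟩ := exists_isClustering_boundary (natAdj_symm G)
      (w := (reweight (natAdj G) M N n)^[∑ i ∈ Finset.range (M * b), Covering.coin l i] fun _ => 1)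
      (reweight_iterate_pos _) hM1 hb1 hT (show n ≤ N by omega)
    set S : Finset ℕ := (Finset.range (Covering.guesses N M k)).image fun j =>
      Covering.ofDigits (fun m => Covering.coin l (M * b + (j * b + m))) b
    have hS : S.card ≤ Covering.guesses N M k := by
      simpa using Finset.card_image_le (s := Finset.range (Covering.guesses N M k))
        (f := fun j => Covering.ofDigits (fun m => Covering.coin l (M * b + (j * b + m))) b)
    have htw := hg.treewidth_induce_le hcl S
      (A := Covering.coverSet G M N b (Covering.guesses N M k) l) (by
        rintro v (hv | ⟨j, hj, hv⟩)
        · exact Or.inl hv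
        · exact Or.inr (Finset.mem_image.2 ⟨j, Finset.mem_range.2 hj, hv⟩))
    have htw' : (treewidth (G.induce (Covering.coverSet G M N b (Covering.guesses N M k) l)) : ℝ) ≤
        Covering.guesses N M k + (Δ + 1) * ((D + 1) * (2 * D * (M * b : ℕ) + 1) ^ e) := by
      have := htw.trans (Nat.add_le_add_right hS _)
      exact_mod_cast this
    refine htw'.trans ?_
    rw [hκe]
    have h4 : (2 * D * ((M * b : ℕ) : ℝ) + 1) ^ e ≤ (2 * D * R + 1) ^ e * κ ^ e := by
      rw [← mul_pow]
      gcongr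
      have : 2 * (D : ℝ) * ((M * b : ℕ) : ℝ) ≤ 2 * D * (R * κ) := by gcongr
      nlinarith
    have h5 : ((Δ : ℝ) + 1) * ((D + 1) * (2 * D * ((M * b : ℕ) : ℝ) + 1) ^ e) ≤
        (Δ + 1) * ((D + 1) * ((2 * D * R + 1) ^ e * κ ^ e)) := by gcongr
    have h6 : (Δ + 1) * ((D + 1) * ((2 * D * R + 1) ^ e * κ ^ e)) ≤
        (Δ + 1) * ((D + 1) * ((2 * D * R + 1) ^ e * κ ^ e)) * Real.log k :=
      le_mul_of_one_le_right (by positivity) hlogk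
    calc _ ≤ R * κ ^ e * Real.log k +
          (Δ + 1) * ((D + 1) * ((2 * D * R + 1) ^ e * κ ^ e)) * Real.log k :=
        add_le_add h3 (h5.trans h6)
      _ = _ := by ring
  · obtain ⟨l, hl, hXl⟩ := Covering.exists_coins G hM1 hb0 hb1 hT (show n ≤ N by omega) hX
    refine le_trans ?_ (hprob l hl X hXl)
    set m := M * b + Covering.guesses N M k * b with hm
    have hmle : (m : ℝ) ≤ (R + R * R) * ((X.card : ℝ) + k) * (k : ℝ) ^ (-(1 / ((e + 1 : ℕ) : ℝ))) *
        Real.log k ^ 2 := by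
      have h4 : (k : ℝ) * (k : ℝ) ^ (-(1 / ((e + 1 : ℕ) : ℝ))) = κ ^ e := by
        rw [← hκe, sub_eq_add_neg, Real.rpow_add hk0, Real.rpow_one]
      have h5 : (m : ℝ) ≤ (R + R * R) * (κ ^ e * Real.log k ^ 2) := by
        have h6 : (m : ℝ) = ((M * b : ℕ) : ℝ) + Covering.guesses N M k * b := by
          rw [hm]; push_cast; ring
        have h7 : (Covering.guesses N M k : ℝ) * b ≤
            (R * κ ^ e * Real.log k) * (R * Real.log k) := by
          gcongr
        have h8 : R * κ ≤ R * (κ ^ e * Real.log k ^ 2) := by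
          gcongr
          nlinarith [one_le_pow₀ hlogk (n := 2), one_le_pow₀ hκ1 (n := e)]
        rw [h6]
        nlinarith
      refine h5.trans ?_
      rw [← h4]
      have h9 : (k : ℝ) ≤ (X.card : ℝ) + k := by
        have : (0 : ℝ) ≤ X.card := by positivity
        linarith
      calc (R + R * R) * ((k : ℝ) * (k : ℝ) ^ (-(1 / ((e + 1 : ℕ) : ℝ))) * Real.log k ^ 2)
          ≤ (R + R * R) * (((X.card : ℝ) + k) * (k : ℝ) ^ (-(1 / ((e + 1 : ℕ) : ℝ))) *
            Real.log k ^ 2) := by gcongr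
        _ = _ := by ring
    have h10 : (2⁻¹ : ENNReal) ^ m = ENNReal.ofReal ((2 : ℝ) ^ (-(m : ℝ))) := by
      rw [Real.rpow_neg (by norm_num), Real.rpow_natCast, ← inv_pow,
        ENNReal.ofReal_pow (by norm_num), ENNReal.ofReal_inv_of_pos (by norm_num)]
      simp
    rw [h10]
    refine ENNReal.ofReal_le_ofReal ?_
    exact Real.rpow_le_rpow_of_exponent_le (by norm_num) (neg_le_neg hmle)
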